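/- **Setting.** Let $G$ be a second countable locally compact Hausdorff groupoid with unit space $G^{(0)}$, range and source maps $r,s$ and left Haar system $\lambda=\{\lambda^u\}$, $\lambda^u$ supported on $G^u=r^{-1}(u)$. Let $H\subseteq G$ be a closed subgroupoid with $H^{(0)}=G^{(0)}$ and with its own Haar system $\beta$. A measure $\mu$ on $G^{(0)}$ is *quasi-invariant* for $(G,\lambda)$ if $\nu=\mu\circ\lambda=\int\lambda^u\,d\mu(u)$ and its image $\nu^{-1}$ under inversion have the same null sets. A *unitary representation* of $G$ is a triple $L=(\mu,G^{(0)}*\mathcal H,\hat L)$ of a quasi-invariant measure $\mu$, a Borel Hilbert bundle with fibres $\mathcal H(u)$, and a Borel homomorphism $g\mapsto L_g$, where $L_g:\mathcal H(s(g))\to\mathcal H(r(g))$ is unitary. Tensor products are formed fibrewise and $L|_H$ is the restriction of $\hat L$ to $H$. Two representations $L,L'$ over the same $\mu$ are *equivalent* if there is an isomorphism of Borel Hilbert bundles given by unitaries $U(u):\mathcal H(u)\to\mathcal H'(u)$ with $U(r(g))L_g=L'_gU(s(g))$ for all $g\in G$. **Induction.** $G$ acts on $G/H$ by left translation, with anchor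 map $\omega(gH)=r(g)$ and fibres $(G/H)_u=\omega^{-1}(u)$. Let $\mu$ be a measure on $G^{(0)}$. Let $m$ be a $G$-quasi-invariant probability measure on $G/H$ in the measure class of the image of $\nu^{-1}$ under $G\to G/H$; that is, $m=\int m_u\,d\tilde m(u)$ with $\tilde m=\omega_*m$ quasi-invariant for $G$, where $\{m_u\}$ is a Borel family of Radon measures on the fibres $(G/H)_u$ and $g\,m_{s(g)}\sim m_{r(g)}$ for every $g\in G$. If $\mu$ is quasi-invariant for $G$, then $\tilde m\sim\mu$. For a unitary representation $M=(\mu,H^{(0)}*\mathcal K,\hat M)$ of $H$, the representation $\operatorname{Ind}_H^G M$ of $G$, over $\tilde m$, has as fibre at $u$ the Hilbert space completion of the space of Borel sections $\xi$ on $G^u$ with $\xi(x)\in\mathcal K(s(x))$, $\xi(xh)=M_{h^{-1}}\xi(x)$ for $h\in H$ with $r(h)=s(x)$, and $\int_{(G/H)_u}\|\xi(x)\|^2\,dm_u(xH)<\infty$; the Borel structure of the bundle is the one determined by the equivariant Borel sections over $G$, and $$(\operatorname{Ind}_H^G M)_g\,\xi(x)=D(g^{-1},xH)^{1/2}\,\xi(g^{-1}x),\qquad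 D(g^{-1},\cdot)=\frac{d(g\,m_{s(g)})}{dm_{r(g)}} .$$ **Proposition.** Let $L=(\mu,G^{(0)}*\mathcal H,\hat L)$ be a unitary representation of $G$ and $M=(\mu,H^{(0)}*\mathcal K,\hat M)$ a unitary representation of $H$, over the same measure $\mu$, and let $m$ be any measure on $G/H$ as above, used for both inductions. Then $$L\otimes\operatorname{Ind}_H^G M\;\cong\;\operatorname{Ind}_H^G\big((L|_H)\otimes M\big),$$ where on the left $L$ is regarded as a representation over the equivalent quasi-invariant measure $\tilde m$. More precisely, there is an equivalence given by unitaries $U(u)$, $u\in G^{(0)}$, which satisfy $$\big(U(u)(\xi\otimes\eta)\big)(x)=L_{x^{-1}}\xi\otimes\eta(x),\qquad x\in G^u,$$ for all $\xi\in\mathcal H(u)$ and all square integrable equivariant Borel sections $\eta$ on $G^u$; the right-hand side is again a square integrable equivariant Borel section. -/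

import Mathlib

open CategoryTheory MeasureTheory Topology
open scoped ENNReal TensorProduct

universe u v w w'

noncomputable section

namespace TopGpd

/-! ### Topological groupoids

The set of units is a type `X`, and an arrow `g : a ⟶ b` has source `a` and range `b`.
The product `g h` of the groupoid is the composite `h ≫ g`. -/

section Basic

variable (X : Type u) [Groupoid.{v} X]

/-- The total space of arrows of the groupoid: the set usually denoted `G`. -/
structure Arr where
  src : X
  tgt : X
  hom : src ⟶ tgt

variable {X}

/-- The unit at `a`. -/
def Arr.unit (a : X) : Arr X := ⟨a, a, 𝟙 a⟩

/-- The inverse of an arrow. -/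
def Arr.inv (g : Arr X) : Arr X := ⟨g.tgt, g.src, Groupoid.inv g.hom⟩

variable (X) in
/-- The set of composable pairs. -/
structure ComposablePair where
  {x y z : X}
  snd : x ⟶ y
  fst : y ⟶ z

/-- The pair of arrows of a composable pair. -/
def ComposablePair.toProd (p : ComposablePair X) : Arr X × Arr X :=
  (⟨p.y, p.z, p.fst⟩, ⟨p.x, p.y, p.snd⟩)

/-- The product of a composable pair. -/
def ComposablePair.mul (p : ComposablePair X) : Arr X := ⟨p.x, p.z, p.snd ≫ p.fst⟩

/-- The fibre `G^u` of all arrows with range `u`. -/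
structure Fib (u : X) where
  src : X
  hom : src ⟶ u

/-- The inclusion of `G^u` in `G`. -/
def Fib.toArr {u : X} (x : Fib u) : Arr X := ⟨x.src, u, x.hom⟩

/-- Left multiplication `x ↦ g x` by `g : u ⟶ v`, a map `G^u → G^v`. -/
def Fib.lmul {u v : X} (g : u ⟶ v) (x : Fib u) : Fib v := ⟨x.src, x.hom ≫ g⟩

variable [TopologicalSpace (Arr X)]

instance : TopologicalSpace (ComposablePair X) :=
  TopologicalSpace.induced ComposablePair.toProd instTopologicalSpaceProd

instance (u : X) : TopologicalSpace (Fib u) := TopologicalSpace.induced Fib.toArr inferInstance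

instance : MeasurableSpace (Arr X) := borel _
instance : BorelSpace (Arr X) := ⟨rfl⟩
instance (u : X) : MeasurableSpace (Fib u) := borel _
instance (u : X) : BorelSpace (Fib u) := ⟨rfl⟩

end Basic

/-- Second countable locally compact Hausdorff groupoids. As the maps `unit` and `src` are
continuous, the topology of the unit space `X` is the one that it has as a subspace of `G`. -/
class IsLCGroupoid (X : Type u) [Groupoid.{v} X] [TopologicalSpace X]
    [TopologicalSpace (Arr X)] : Prop where
  t2 : T2Space (Arr X)
  locallyCompact : LocallyCompactSpace (Arr X)
  secondCountable : SecondCountableTopology (Arr X)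
  continuous_src : Continuous (Arr.src : Arr X → X)
  continuous_tgt : Continuous (Arr.tgt : Arr X → X)
  continuous_unit : Continuous (Arr.unit : X → Arr X)
  continuous_inv : Continuous (Arr.inv : Arr X → Arr X)
  continuous_mul : Continuous (ComposablePair.mul : ComposablePair X → Arr X)

/-- A left Haar system `{λ^u}`. -/
structure HaarSystem (X : Type u) [Groupoid.{v} X] [TopologicalSpace X]
    [TopologicalSpace (Arr X)] where
  meas : ∀ u : X, Measure (Fib u)
  finiteOnCompacts : ∀ u, IsFiniteMeasureOnCompacts (meas u)
  fullSupport : ∀ u, (meas u).IsOpenPosMeasure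
  continuous_integral : ∀ f : Arr X → ℝ, Continuous f → HasCompactSupport f →
    Continuous fun u => ∫ x : Fib u, f x.toArr ∂(meas u)
  map_lmul : ∀ {u v : X} (g : u ⟶ v), (meas u).map (Fib.lmul g) = meas v

section QuasiInvariance

variable {X : Type u} [Groupoid.{v} X] [TopologicalSpace X] [TopologicalSpace (Arr X)]
  [MeasurableSpace X]

/-- The measure `μ ∘ λ = ∫ λ^u dμ(u)` on `G`. -/
def HaarSystem.induced (lam : HaarSystem X) (μ : Measure X) : Measure (Arr X) :=
  μ.bind fun u => (lam.meas u).map Fib.toArr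

/-- `μ` is quasi-invariant if `ν = μ ∘ λ` and its image under inversion have the same
null sets. -/
def QuasiInvariant (lam : HaarSystem X) (μ : Measure X) : Prop :=
  lam.induced μ ≪ (lam.induced μ).map Arr.inv ∧ (lam.induced μ).map Arr.inv ≪ lam.induced μ

end QuasiInvariance

/-! ### Closed subgroupoids with the same unit space -/

/-- A closed subgroupoid of `G` with the same unit space. -/
structure ClosedSubgroupoid (X : Type u) [Groupoid.{v} X] [TopologicalSpace (Arr X)] where
  toSubgroupoid : Subgroupoid X
  isWide : toSubgroupoid.IsWide
  isClosed : IsClosed {g : Arr X | g.hom ∈ toSubgroupoid.arrows g.src g.tgt}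

namespace ClosedSubgroupoid

variable {X : Type u} [Groupoid.{v} X] [TopologicalSpace X] [TopologicalSpace (Arr X)]

/-- The unit space of `H`, a copy of `X` that carries the arrows of `H` instead of those
of `G`. -/
def Units (_H : ClosedSubgroupoid X) : Type u := X

variable (H : ClosedSubgroupoid X)

instance : Groupoid.{v} H.Units where
  Hom a b := H.toSubgroupoid.arrows a b
  id a := ⟨𝟙 _, H.isWide.id_mem a⟩
  comp f g := ⟨f.1 ≫ g.1, H.toSubgroupoid.mul f.2 g.2⟩
  inv f := ⟨Groupoid.inv f.1, H.toSubgroupoid.inv f.2⟩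
  id_comp f := Subtype.ext (Category.id_comp f.1)
  comp_id f := Subtype.ext (Category.comp_id f.1)
  assoc f g h := Subtype.ext (Category.assoc f.1 g.1 h.1)
  inv_comp f := Subtype.ext (Groupoid.inv_comp f.1)
  comp_inv f := Subtype.ext (Groupoid.comp_inv f.1)

/-- A unit of `G`, seen as a unit of `H`. -/
def unit (a : X) : H.Units := a

/-- The arrow of `G` underlying an arrow of `H`. -/
def coeHom {a b : H.Units} (h : a ⟶ b) : @Quiver.Hom X _ a b := h.1

/-- The arrow of `H` given by an arrow of `G` that lies in `H`. -/
def mkHom {a b : X} (h : a ⟶ b) (hh : h ∈ H.toSubgroupoid.arrows a b) :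
    H.unit a ⟶ H.unit b := ⟨h, hh⟩

/-- The inclusion of `H` in `G`. -/
def incl (h : Arr H.Units) : Arr X := ⟨h.src, h.tgt, H.coeHom h.hom⟩

instance : TopologicalSpace H.Units := inferInstanceAs (TopologicalSpace X)
instance [MeasurableSpace X] : MeasurableSpace H.Units := inferInstanceAs (MeasurableSpace X)
instance [MeasurableSpace X] [BorelSpace X] : BorelSpace H.Units :=
  inferInstanceAs (BorelSpace X)
instance : TopologicalSpace (Arr H.Units) :=
  TopologicalSpace.induced H.incl inferInstance

/-- Two elements of `G^u` are equivalent if they lie in the same left coset of `H`. -/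
def fibSetoid (u : X) : Setoid (Fib u) where
  r x y := ∃ h : y.src ⟶ x.src, h ∈ H.toSubgroupoid.arrows _ _ ∧ y.hom = h ≫ x.hom
  iseqv :=
    { refl := fun x => ⟨𝟙 _, H.isWide.id_mem _, (Category.id_comp _).symm⟩
      symm := by
        rintro x y ⟨h, hh, e⟩
        refine ⟨Groupoid.inv h, H.toSubgroupoid.inv hh, ?_⟩
        rw [e, ← Category.assoc, Groupoid.inv_comp, Category.id_comp]
      trans := by
        rintro x y z ⟨h, hh, e⟩ ⟨k, hk, e'⟩
        exact ⟨k ≫ h, H.toSubgroupoid.mul hk hh, by rw [e', e, Category.assoc]⟩ }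

/-- The fibre `(G/H)_u = G^u / H`. -/
def FibCoset (u : X) : Type _ := Quotient (H.fibSetoid u)

/-- Two arrows are equivalent if they lie in the same left coset of `H`. -/
def cosetRel (g k : Arr X) : Prop :=
  ∃ (u : X) (x y : Fib u), H.fibSetoid u x y ∧ g = x.toArr ∧ k = y.toArr

/-- The space `G/H` of left cosets. -/
def CosetSpace : Type _ := Quot H.cosetRel

/- The Borel structures on `G/H` and `(G/H)_u` are the quotient structures. -/
instance : MeasurableSpace H.CosetSpace := inferInstanceAs (MeasurableSpace (Quot _))
instance (u : X) : TopologicalSpace (H.FibCoset u) :=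
  inferInstanceAs (TopologicalSpace (Quotient _))
instance (u : X) : MeasurableSpace (H.FibCoset u) :=
  inferInstanceAs (MeasurableSpace (Quotient _))

/-- The quotient map `G^u → (G/H)_u`. -/
def fibMk {u : X} (x : Fib u) : H.FibCoset u := Quotient.mk (H.fibSetoid u) x

/-- A representative of a coset. -/
def rep {u : X} (q : H.FibCoset u) : Fib u := @Quotient.out _ (H.fibSetoid u) q

/-- The quotient map `G → G/H`. -/
def cosetMk (g : Arr X) : H.CosetSpace := Quot.mk _ g

/-- The inclusion of `(G/H)_u` in `G/H`. -/
def fibIncl (u : X) : H.FibCoset u → H.CosetSpace :=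
  Quotient.lift (fun x : Fib u => H.cosetMk x.toArr)
    fun x y h => Quot.sound ⟨u, x, y, h, rfl, rfl⟩

/-- The anchor map `ω : G/H → X`, `ω(gH) = r(g)`. -/
def anchor : H.CosetSpace → X :=
  Quot.lift Arr.tgt (by rintro _ _ ⟨u, x, y, -, rfl, rfl⟩; rfl)

/-- The action of `g : u ⟶ v` on cosets, `xH ↦ gxH`, a map `(G/H)_u → (G/H)_v`. -/
def act {u v : X} (g : u ⟶ v) : H.FibCoset u → H.FibCoset v :=
  Quotient.lift (fun x : Fib u => H.fibMk (x.lmul g)) (by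
    rintro x y ⟨h, hh, e⟩
    refine Quotient.sound (s := H.fibSetoid v) ⟨h, hh, ?_⟩
    simp [Fib.lmul, e])

end ClosedSubgroupoid
section BasicFacts

set_option linter.unusedSectionVars false

variable {X : Type u} [Groupoid.{v} X] [TopologicalSpace X] [TopologicalSpace (Arr X)]

theorem Fib.continuous_toArr (u : X) : Continuous (Fib.toArr : Fib u → Arr X) :=
  continuous_induced_dom

theorem Fib.toArr_injective (u : X) : Function.Injective (Fib.toArr : Fib u → Arr X) := by
  rintro ⟨a, f⟩ ⟨b, g⟩ h
  simp only [Fib.toArr, Arr.mk.injEq, true_and] at h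
  obtain ⟨rfl, h⟩ := h
  simpa using h

variable [IsLCGroupoid X]

theorem Fib.continuous_src (u : X) : Continuous (Fib.src : Fib u → X) :=
  IsLCGroupoid.continuous_src.comp (Fib.continuous_toArr u)

theorem Fib.continuous_lmul {u v : X} (g : u ⟶ v) : Continuous (Fib.lmul g) := by
  refine continuous_induced_rng.2 ?_
  have h : Continuous fun x : Fib u => (⟨x.hom, g⟩ : ComposablePair X) :=
    by
    refine continuous_induced_rng.2 ?_
    exact (continuous_const (y := (⟨u, v, g⟩ : Arr X))).prodMk (Fib.continuous_toArr u)
  exact IsLCGroupoid.continuous_mul.comp h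

theorem t2Space_units : T2Space X := by
  have := IsLCGroupoid.t2 (X := X)
  exact T2Space.of_injective_continuous (f := (Arr.unit : X → Arr X))
    (fun a b h => congrArg Arr.src h) IsLCGroupoid.continuous_unit

theorem Fib.isClosedEmbedding_toArr (u : X) :
    IsClosedEmbedding (Fib.toArr : Fib u → Arr X) := by
  have := t2Space_units (X := X)
  refine ⟨⟨⟨rfl⟩, Fib.toArr_injective u⟩, ?_⟩
  have : Set.range (Fib.toArr : Fib u → Arr X) = Arr.tgt ⁻¹' {u} := by
    ext ⟨a, b, f⟩
    constructor
    · rintro ⟨x, hx⟩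
      exact (congrArg Arr.tgt hx).symm
    · rintro h
      obtain rfl : b = u := h
      exact ⟨⟨a, f⟩, rfl⟩
  rw [this]
  exact isClosed_singleton.preimage IsLCGroupoid.continuous_tgt

variable [MeasurableSpace X] [BorelSpace X]

theorem HaarSystem.measurable_map_toArr (lam : HaarSystem X) :
    Measurable fun u => (lam.meas u).map (Fib.toArr : Fib u → Arr X) := by
  have := IsLCGroupoid.t2 (X := X)
  have := IsLCGroupoid.locallyCompact (X := X)
  have := IsLCGroupoid.secondCountable (X := X)
  let := TopologicalSpace.metrizableSpaceMetric (Arr X)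
  set κ : X → Measure (Arr X) := fun u => (lam.meas u).map (Fib.toArr : Fib u → Arr X) with hκ
  have hm : ∀ u : X, Measurable (Fib.toArr : Fib u → Arr X) :=
    fun u => (Fib.continuous_toArr u).measurable
  -- integrals of nonnegative compactly supported functions
  have hint : ∀ f : Arr X → ℝ, Continuous f → HasCompactSupport f → (∀ g, 0 ≤ f g) →
      (Measurable fun u => ∫⁻ g, ENNReal.ofReal (f g) ∂(κ u)) ∧
        ∀ u, ∫⁻ g, ENNReal.ofReal (f g) ∂(κ u) < ∞ := by
    intro f hf hc h0
    have hi : ∀ u : X, Integrable (fun x : Fib u => f x.toArr) (lam.meas u) := by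
      intro u
      have := lam.finiteOnCompacts u
      exact (hf.comp (Fib.continuous_toArr u)).integrable_of_hasCompactSupport
        (hc.comp_isClosedEmbedding (Fib.isClosedEmbedding_toArr u))
    have he : ∀ u : X, ∫⁻ g, ENNReal.ofReal (f g) ∂(κ u) =
        ENNReal.ofReal (∫ x : Fib u, f x.toArr ∂(lam.meas u)) := by
      intro u
      rw [hκ, lintegral_map hf.measurable.ennreal_ofReal (hm u),
        ofReal_integral_eq_lintegral_ofReal (hi u) (Filter.Eventually.of_forall fun x => h0 _)]
    refine ⟨?_, fun u => by rw [he]; exact ENNReal.ofReal_lt_top⟩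
    simp_rw [he]
    exact (lam.continuous_integral f hf hc).measurable.ennreal_ofReal
  -- a compact exhaustion
  let K : CompactExhaustion (Arr X) := default
  have hφ := fun n => exists_continuousMap_one_of_isCompact_subset_isOpen
    (K.isCompact n) isOpen_univ (Set.subset_univ _)
  choose φ hφ1 hφc hφs hφ01 using hφ
  let κ' : ℕ → X → Measure (Arr X) := fun n u =>
    (κ u).withDensity fun g => ENNReal.ofReal (φ n g)
  have hfin : ∀ n u, IsFiniteMeasure (κ' n u) := by
    intro n u
    refine ⟨?_⟩
    rw [withDensity_apply _ MeasurableSet.univ, Measure.restrict_univ]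
    exact (hint (φ n) (φ n).continuous (hφc n) fun g => (hφ01 n g).1).2 u
  have hcl : ∀ n, ∀ F : Set (Arr X), IsClosed F → Measurable fun u => κ' n u F := by
    intro n F hF
    have hlim : ∀ u, Filter.Tendsto (fun k => ∫⁻ g, (hF.apprSeq k g : ℝ≥0∞) ∂(κ' n u))
        Filter.atTop (𝓝 (κ' n u F)) := fun u =>
      HasOuterApproxClosed.tendsto_lintegral_apprSeq hF (κ' n u)
    refine measurable_of_tendsto_metrizable (f := fun k u =>
      ∫⁻ g, (hF.apprSeq k g : ℝ≥0∞) ∂(κ' n u)) (fun k => ?_) (tendsto_pi_nhds.2 hlim)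
    have he : ∀ u, ∫⁻ g, (hF.apprSeq k g : ℝ≥0∞) ∂(κ' n u) =
        ∫⁻ g, ENNReal.ofReal (φ n g * (hF.apprSeq k g : ℝ)) ∂(κ u) := by
      intro u
      rw [lintegral_withDensity_eq_lintegral_mul _ (φ n).continuous.measurable.ennreal_ofReal
        (hF.apprSeq k).continuous.measurable.coe_nnreal_ennreal]
      refine lintegral_congr fun g => ?_
      rw [ENNReal.ofReal_mul (hφ01 n g).1, ENNReal.ofReal_coe_nnreal]
      rfl
    simp_rw [he]
    refine (hint _ ((φ n).continuous.mul (NNReal.continuous_coe.comp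
      (hF.apprSeq k).continuous)) ?_ fun g => mul_nonneg (hφ01 n g).1 (NNReal.coe_nonneg _)).1
    exact HasCompactSupport.mul_right (hφc n)
  have hmeas : ∀ n, Measurable (κ' n) := fun n =>
    Measurable.measure_of_isPiSystem
      ((BorelSpace.measurable_eq (α := Arr X)).trans borel_eq_generateFrom_isClosed)
      isPiSystem_isClosed (hcl n) (hcl n _ isClosed_univ)
  refine Measure.measurable_of_measurable_coe _ fun B hB => ?_
  have hsup : ∀ u, κ u B = ⨆ n, κ' n u (B ∩ K n) := by
    intro u
    have h1 : ∀ n, κ' n u (B ∩ K n) = κ u (B ∩ K n) := by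
      intro n
      have hmK : MeasurableSet (B ∩ K n) := hB.inter (K.isCompact n).measurableSet
      rw [withDensity_apply _ hmK]
      calc _ = ∫⁻ g in B ∩ K n, 1 ∂(κ u) := by
            refine setLIntegral_congr_fun hmK fun g hg => ?_
            have h := hφ1 n hg.2
            simp only [Pi.one_apply] at h
            simp [h]
        _ = _ := by simp
    simp_rw [h1]
    rw [← Monotone.measure_iUnion, ← Set.inter_iUnion, K.iUnion_eq, Set.inter_univ]
    exact fun a b hab => Set.inter_subset_inter_right _ (K.subset hab)
  change Measurable fun u => κ u B
  simp_rw [hsup]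
  exact Measurable.iSup fun n => (Measure.measurable_coe
    (hB.inter (K.isCompact n).measurableSet)).comp (hmeas n)

theorem HaarSystem.induced_apply (lam : HaarSystem X) (μ : Measure X) {B : Set (Arr X)}
    (hB : MeasurableSet B) :
    lam.induced μ B = ∫⁻ u, lam.meas u (Fib.toArr ⁻¹' B) ∂μ := by
  rw [HaarSystem.induced, Measure.bind_apply hB lam.measurable_map_toArr.aemeasurable]
  refine lintegral_congr fun u => ?_
  rw [Measure.map_apply (Fib.continuous_toArr u).measurable hB]

/-- The image of `μ ∘ λ` under the range map is equivalent to `μ`. -/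
theorem HaarSystem.induced_tgt_eq_zero_iff (lam : HaarSystem X) (μ : Measure X) {B : Set X}
    (hB : MeasurableSet B) : lam.induced μ (Arr.tgt ⁻¹' B) = 0 ↔ μ B = 0 := by
  have hB' : MeasurableSet (Arr.tgt ⁻¹' B : Set (Arr X)) :=
    IsLCGroupoid.continuous_tgt.measurable hB
  have hm : Measurable fun u => lam.meas u (Fib.toArr ⁻¹' (Arr.tgt ⁻¹' B : Set (Arr X))) := by
    have h := (Measure.measurable_coe hB').comp lam.measurable_map_toArr
    have he : (fun u => lam.meas u (Fib.toArr ⁻¹' (Arr.tgt ⁻¹' B : Set (Arr X)))) =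
        (fun ν : Measure (Arr X) => ν (Arr.tgt ⁻¹' B)) ∘
          fun u => (lam.meas u).map (Fib.toArr : Fib u → Arr X) :=
      funext fun u => (Measure.map_apply (Fib.continuous_toArr u).measurable hB').symm
    rwa [he]
  rw [lam.induced_apply μ hB', lintegral_eq_zero_iff hm]
  have hiff : ∀ u, lam.meas u (Fib.toArr ⁻¹' (Arr.tgt ⁻¹' B : Set (Arr X))) = 0 ↔ u ∉ B := by
    intro u
    by_cases hu : u ∈ B
    · have : (Fib.toArr ⁻¹' (Arr.tgt ⁻¹' B : Set (Arr X)) : Set (Fib u)) = Set.univ :=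
        Set.eq_univ_of_forall fun x => hu
      have hp := lam.fullSupport u
      have hne : Nonempty (Fib u) := ⟨⟨u, 𝟙 u⟩⟩
      rw [this]
      simpa [hu] using hp.open_pos Set.univ isOpen_univ Set.univ_nonempty
    · have : (Fib.toArr ⁻¹' (Arr.tgt ⁻¹' B : Set (Arr X)) : Set (Fib u)) = ∅ :=
        Set.eq_empty_of_forall_notMem fun x => hu
      simp [this, hu]
  rw [measure_eq_zero_iff_ae_notMem]
  exact Filter.eventually_congr (Filter.Eventually.of_forall hiff)

end BasicFacts
/-! ### Borel Hilbert bundles -/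

/-- A family of complex Hilbert spaces over `X` with a set of sections that determines its
Borel structure: a section is Borel if its inner products with the members of `gen` are. -/
structure HilbertBundle (X : Type u) where
  fiber : X → Type w
  [normedAddCommGroup : ∀ u, NormedAddCommGroup (fiber u)]
  [innerProductSpace : ∀ u, InnerProductSpace ℂ (fiber u)]
  [completeSpace : ∀ u, CompleteSpace (fiber u)]
  gen : Set (∀ u, fiber u)

attribute [instance] HilbertBundle.normedAddCommGroup HilbertBundle.innerProductSpace
  HilbertBundle.completeSpace

theorem dense_span_tmul {E : Type w} {F : Type w'} [NormedAddCommGroup E]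
    [InnerProductSpace ℂ E] [NormedAddCommGroup F] [InnerProductSpace ℂ F] {s : Set E} {t : Set F}
    (hs : Dense (Submodule.span ℂ s : Set E)) (ht : Dense (Submodule.span ℂ t : Set F)) :
    Dense (Submodule.span ℂ (Set.image2 (fun x y => ((x ⊗ₜ[ℂ] y : E ⊗[ℂ] F) :
      UniformSpace.Completion (E ⊗[ℂ] F))) s t) : Set (UniformSpace.Completion (E ⊗[ℂ] F))) := by
  let B : E →ₗ[ℂ] F →ₗ[ℂ] UniformSpace.Completion (E ⊗[ℂ] F) :=
    (TensorProduct.mk ℂ E F).compr₂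
      (UniformSpace.Completion.toComplₗᵢ (𝕜 := ℂ) (E := E ⊗[ℂ] F)).toLinearMap
  set S : Submodule ℂ (UniformSpace.Completion (E ⊗[ℂ] F)) :=
    Submodule.span ℂ (Set.image2 (fun x y => ((x ⊗ₜ[ℂ] y : E ⊗[ℂ] F) :
      UniformSpace.Completion (E ⊗[ℂ] F))) s t) with hS
  have hBc : Continuous fun p : E × F => B p.1 p.2 :=
    (UniformSpace.Completion.continuous_coe _).comp TensorProduct.continuous_tmul
  have h1 : ∀ x ∈ Submodule.span ℂ s, ∀ y ∈ Submodule.span ℂ t, B x y ∈ S := by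
    intro x hx y hy
    have h := Submodule.apply_mem_map₂ B hx hy
    rw [Submodule.map₂_span_span] at h
    exact h
  have hT : ∀ x y, B x y ∈ S.topologicalClosure := by
    intro x y
    have hd := hs.prod ht
    have hsub : (Submodule.span ℂ s : Set E) ×ˢ (Submodule.span ℂ t : Set F) ⊆
        {p : E × F | B p.1 p.2 ∈ S.topologicalClosure} := by
      rintro ⟨p, q⟩ hp
      have hp' := Set.mem_prod.1 hp
      exact S.le_topologicalClosure (h1 p hp'.1 q hp'.2)
    have hcl : IsClosed {p : E × F | B p.1 p.2 ∈ S.topologicalClosure} :=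
      S.isClosed_topologicalClosure.preimage hBc
    have hmem := closure_minimal hsub hcl (hd (x, y))
    exact hmem
  intro z
  change z ∈ (S.topologicalClosure : Set (UniformSpace.Completion (E ⊗[ℂ] F)))
  induction z using UniformSpace.Completion.induction_on with
  | hp => exact S.isClosed_topologicalClosure
  | ih r =>
    induction r using TensorProduct.induction_on with
    | zero => exact S.topologicalClosure.zero_mem
    | tmul x y => exact hT x y
    | add r r' h h' =>
      rw [UniformSpace.Completion.coe_add]
      exact S.topologicalClosure.add_mem h h'

namespace HilbertBundle

set_option linter.unusedSectionVars false

variable {X : Type u} [MeasurableSpace X]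

/-- Borel sections. -/
def IsBorelSection (E : HilbertBundle.{u, w} X) (σ : ∀ u, E.fiber u) : Prop :=
  ∀ e ∈ E.gen, Measurable fun u => inner ℂ (e u) (σ u)

/-- Borel Hilbert bundles: the determining sections have Borel inner products, and countably
many of them are total in every fibre. -/
class IsBorel (E : HilbertBundle.{u, w} X) : Prop where
  measurable_inner : ∀ e ∈ E.gen, ∀ f ∈ E.gen, Measurable fun u => inner ℂ (e u) (f u)
  exists_total : ∃ C ⊆ E.gen, C.Countable ∧
    ∀ u, Dense (Submodule.span ℂ ((fun e : ∀ u, E.fiber u => e u) '' C) : Set (E.fiber u))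

/-- The fibrewise Hilbert space tensor product. -/
def tensor (E : HilbertBundle.{u, w} X) (F : HilbertBundle.{u, w'} X) :
    HilbertBundle.{u, max w w'} X where
  fiber u := UniformSpace.Completion (E.fiber u ⊗[ℂ] F.fiber u)
  gen := {σ | ∃ e ∈ E.gen, ∃ f ∈ F.gen, ∀ u, σ u = ((e u ⊗ₜ[ℂ] f u : E.fiber u ⊗[ℂ] F.fiber u) :
    UniformSpace.Completion (E.fiber u ⊗[ℂ] F.fiber u))}

/-- Elementary tensors. -/
def tmul (E : HilbertBundle.{u, w} X) (F : HilbertBundle.{u, w'} X) {u : X} (x : E.fiber u)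
    (y : F.fiber u) : (E.tensor F).fiber u :=
  ((x ⊗ₜ[ℂ] y : E.fiber u ⊗[ℂ] F.fiber u) : UniformSpace.Completion (E.fiber u ⊗[ℂ] F.fiber u))

theorem inner_tmul_tmul (E : HilbertBundle.{u, w} X) (F : HilbertBundle.{u, w'} X) {u : X}
    (x x' : E.fiber u) (y y' : F.fiber u) :
    inner ℂ (E.tmul F x y) (E.tmul F x' y') = inner ℂ x x' * inner ℂ y y' := by
  exact (UniformSpace.Completion.inner_coe _ _).trans (by simp)

instance isBorel_tensor (E : HilbertBundle.{u, w} X) (F : HilbertBundle.{u, w'} X) [E.IsBorel]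
    [F.IsBorel] : (E.tensor F).IsBorel where
  measurable_inner := by
    rintro σ ⟨e, he, f, hf, hσ⟩ τ ⟨e', he', f', hf', hτ⟩
    have h := (IsBorel.measurable_inner e he e' he').mul (IsBorel.measurable_inner f hf f' hf')
    have heq : (fun u => inner ℂ (σ u) (τ u)) =
        fun u => inner ℂ (e u) (e' u) * inner ℂ (f u) (f' u) := by
      funext u
      rw [hσ, hτ]
      exact E.inner_tmul_tmul F _ _ _ _
    rw [heq]
    exact h
  exists_total := by
    obtain ⟨C, hC, hCc, hCd⟩ := IsBorel.exists_total (E := E)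
    obtain ⟨D, hD, hDc, hDd⟩ := IsBorel.exists_total (E := F)
    refine ⟨(fun p : (∀ u, E.fiber u) × (∀ u, F.fiber u) => fun u => E.tmul F (p.1 u) (p.2 u)) ''
      (C ×ˢ D), ?_, (hCc.prod hDc).image _, fun u => ?_⟩
    · rintro _ ⟨p, hp, rfl⟩
      exact ⟨p.1, hC hp.1, p.2, hD hp.2, fun u => rfl⟩
    refine (dense_span_tmul (hCd u) (hDd u)).mono (Submodule.span_mono ?_)
    rintro _ ⟨_, ⟨e, he, rfl⟩, _, ⟨f, hf, rfl⟩, rfl⟩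
    exact ⟨_, ⟨(e, f), ⟨he, hf⟩, rfl⟩, rfl⟩

/-- A Borel family of vectors in the fibres of a Borel Hilbert bundle has a Borel norm. -/
theorem measurable_norm {Ω : Type*} [MeasurableSpace Ω] (E : HilbertBundle.{u, w} X) [E.IsBorel]
    {p : Ω → X} (hp : Measurable p) {ξ : ∀ ω, E.fiber (p ω)}
    (hξ : ∀ e ∈ E.gen, Measurable fun ω => inner ℂ (e (p ω)) (ξ ω)) :
    Measurable fun ω => ‖ξ ω‖ := by
  obtain ⟨C, hC, hCc, hCd⟩ := IsBorel.exists_total (E := E)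
  have : Countable C := hCc
  -- rational combinations of the members of `C`
  let c : ℚ × ℚ →+ ℂ :=
    { toFun := fun q => ⟨(q.1 : ℝ), (q.2 : ℝ)⟩
      map_zero' := by apply Complex.ext <;> simp
      map_add' := fun p q => by apply Complex.ext <;> simp }
  have hcd : DenseRange c := by
    have h := (Rat.denseRange_cast (𝕜 := ℝ)).prodMap (Rat.denseRange_cast (𝕜 := ℝ))
    exact Complex.equivRealProdCLM.symm.surjective.denseRange.comp h
      Complex.equivRealProdCLM.symm.continuous
  let W : (C →₀ ℚ × ℚ) → ∀ u, E.fiber u := fun t u => t.sum fun e q => c q • e.1 u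
  have hWi : ∀ (t : C →₀ ℚ × ℚ) (u : X) (x : E.fiber u), inner ℂ (W t u) x =
      t.sum fun e q => (starRingEnd ℂ) (c q) * inner ℂ (e.1 u) x := by
    intro t u x
    simp only [W, Finsupp.sum, sum_inner, inner_smul_left]
  have hWm : ∀ t t' : C →₀ ℚ × ℚ, Measurable fun u => inner ℂ (W t u) (W t' u) := by
    intro t t'
    simp_rw [hWi]
    refine Finset.measurable_sum _ fun e _ => Measurable.const_mul ?_ _
    simp only [W, Finsupp.sum, inner_sum, inner_smul_right]
    exact Finset.measurable_sum _ fun f _ =>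
      (IsBorel.measurable_inner _ (hC e.2) _ (hC f.2)).const_mul _
  have hWd : ∀ u, DenseRange fun t => W t u := by
    intro u
    let φ : (C →₀ ℚ × ℚ) →+ E.fiber u :=
      Finsupp.liftAddHom fun e => ((smulAddHom ℂ (E.fiber u)).flip (e.1 u)).comp c
    have hφ : ∀ t, φ t = W t u := fun t => rfl
    let A : AddSubgroup (E.fiber u) := φ.range.topologicalClosure
    have hsmul : ∀ (z : ℂ) (e : C), z • e.1 u ∈ A := by
      intro z e
      refine closure_minimal (s := Set.range c) (t := {z : ℂ | z • e.1 u ∈ A}) ?_ ?_ (hcd z)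
      · rintro _ ⟨q, rfl⟩
        refine AddSubgroup.le_topologicalClosure _ ⟨Finsupp.single e q, ?_⟩
        simp [φ]
      · exact (AddSubgroup.isClosed_topologicalClosure _).preimage
          (continuous_id.smul continuous_const)
    have hspan : ∀ x ∈ Submodule.span ℂ ((fun e : ∀ u, E.fiber u => e u) '' C),
        ∀ z : ℂ, z • x ∈ A := by
      intro x hx
      induction hx using Submodule.span_induction with
      | mem x hx =>
        obtain ⟨e, he, rfl⟩ := hx
        exact fun z => hsmul z ⟨e, he⟩
      | zero => intro z; rw [smul_zero]; exact A.zero_mem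
      | add x y _ _ h h' => intro z; rw [smul_add]; exact A.add_mem (h z) (h' z)
      | smul a x _ h => intro z; rw [smul_smul]; exact h _
    intro x
    have h := closure_minimal (s := (Submodule.span ℂ ((fun e : ∀ u, E.fiber u => e u) '' C) :
      Set (E.fiber u))) (t := (A : Set (E.fiber u)))
      (fun x hx => by simpa using hspan x hx 1) (AddSubgroup.isClosed_topologicalClosure _)
      (hCd u x)
    exact h
  -- the norm as a countable supremum
  have hsq : Measurable fun ω => ‖ξ ω‖ ^ 2 := by
    refine Measurable.isLUB (f := fun (t : C →₀ ℚ × ℚ) ω =>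
      2 * (inner ℂ (W t (p ω)) (ξ ω)).re - (inner ℂ (W t (p ω)) (W t (p ω))).re)
      (fun t => ?_) (fun ω => ?_)
    · refine Measurable.sub (Measurable.const_mul (Complex.measurable_re.comp ?_) _)
        (Complex.measurable_re.comp ((hWm t t).comp hp))
      simp_rw [hWi]
      exact Finset.measurable_sum _ fun e _ => (hξ _ (hC e.2)).const_mul _
    · have key : ∀ x : E.fiber (p ω), 2 * (inner ℂ x (ξ ω)).re - (inner ℂ x x).re =
          ‖ξ ω‖ ^ 2 - ‖x - ξ ω‖ ^ 2 := by
        intro x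
        have h1 := norm_sub_sq (𝕜 := ℂ) x (ξ ω)
        have h2 := inner_self_eq_norm_sq (𝕜 := ℂ) x
        simp only [RCLike.re_to_complex] at h1 h2
        linarith
      constructor
      · rintro _ ⟨t, rfl⟩
        simp only [key]
        nlinarith [sq_nonneg ‖W t (p ω) - ξ ω‖]
      · intro b hb
        have hcl : IsClosed {x : E.fiber (p ω) | ‖ξ ω‖ ^ 2 - ‖x - ξ ω‖ ^ 2 ≤ b} :=
          isClosed_le (by fun_prop) continuous_const
        have h := closure_minimal (s := Set.range fun t => W t (p ω)) (by
          rintro _ ⟨t, rfl⟩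
          have h := hb ⟨t, rfl⟩
          simp only [key] at h
          exact h) hcl (hWd (p ω) (ξ ω))
        simpa using h
  have he : (fun ω => ‖ξ ω‖) = fun ω => √(‖ξ ω‖ ^ 2) :=
    funext fun ω => (Real.sqrt_sq (norm_nonneg _)).symm
  rw [he]
  exact hsq.sqrt

theorem measurable_inner_of {Ω : Type*} [MeasurableSpace Ω] (E : HilbertBundle.{u, w} X)
    [E.IsBorel] {p : Ω → X} (hp : Measurable p) {ξ η : ∀ ω, E.fiber (p ω)}
    (hξ : ∀ e ∈ E.gen, Measurable fun ω => inner ℂ (e (p ω)) (ξ ω))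
    (hη : ∀ e ∈ E.gen, Measurable fun ω => inner ℂ (e (p ω)) (η ω)) :
    Measurable fun ω => inner ℂ (ξ ω) (η ω) := by
  have h : ∀ c : ℂ, Measurable fun ω => ‖ξ ω + c • η ω‖ := fun c =>
    E.measurable_norm hp fun e he => by
      simp only [inner_add_right, inner_smul_right]
      exact (hξ e he).add ((hη e he).const_mul c)
  have h1 := h 1
  have h2 := h (-1)
  have h3 := h Complex.I
  have h4 := h (-Complex.I)
  simp only [one_smul, neg_smul, ← sub_eq_add_neg] at h1 h2 h3 h4
  simp_rw [inner_eq_sum_norm_sq_div_four (𝕜 := ℂ)]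
  simp only [RCLike.I_to_complex]
  refine Measurable.div_const ?_ _
  fun_prop

end HilbertBundle

/-! ### Unitary representations -/

section Completion

variable {E F : Type*} [SeminormedAddCommGroup E] [InnerProductSpace ℂ E]
  [SeminormedAddCommGroup F] [InnerProductSpace ℂ F]

/-- Maps between pre-Hilbert spaces that preserve norms and are inverse to each other up to
vectors of norm zero extend to an isomorphism of the completions. -/
def complEquiv (f : E →ₗᵢ[ℂ] F) (g : F →ₗᵢ[ℂ] E) (hfg : ∀ y, ‖f (g y) - y‖ = 0)
    (hgf : ∀ x, ‖g (f x) - x‖ = 0) :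
    UniformSpace.Completion E ≃ₗᵢ[ℂ] UniformSpace.Completion F where
  toFun := f.toContinuousLinearMap.completion
  invFun := g.toContinuousLinearMap.completion
  map_add' := map_add _
  map_smul' := map_smul _
  left_inv x := by
    induction x using UniformSpace.Completion.induction_on with
    | hp => exact isClosed_eq (by fun_prop) continuous_id
    | ih x =>
      rw [ContinuousLinearMap.completion_apply_coe, ContinuousLinearMap.completion_apply_coe,
        ← sub_eq_zero, ← UniformSpace.Completion.coe_sub, ← norm_eq_zero,
        UniformSpace.Completion.norm_coe]
      exact hgf x
  right_inv x := by
    induction x using UniformSpace.Completion.induction_on with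
    | hp => exact isClosed_eq (by fun_prop) continuous_id
    | ih x =>
      rw [ContinuousLinearMap.completion_apply_coe, ContinuousLinearMap.completion_apply_coe,
        ← sub_eq_zero, ← UniformSpace.Completion.coe_sub, ← norm_eq_zero,
        UniformSpace.Completion.norm_coe]
      exact hfg x
  norm_map' x := by
    change ‖f.toContinuousLinearMap.completion x‖ = ‖x‖
    induction x using UniformSpace.Completion.induction_on with
    | hp => exact isClosed_eq (by fun_prop) (by fun_prop)
    | ih x =>
      rw [ContinuousLinearMap.completion_apply_coe, UniformSpace.Completion.norm_coe,
        UniformSpace.Completion.norm_coe]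
      exact f.norm_map x

theorem complEquiv_coe (f : E →ₗᵢ[ℂ] F) (g : F →ₗᵢ[ℂ] E) (hfg : ∀ y, ‖f (g y) - y‖ = 0)
    (hgf : ∀ x, ‖g (f x) - x‖ = 0) (x : E) :
    complEquiv f g hfg hgf (x : UniformSpace.Completion E) = (f x : F) :=
  ContinuousLinearMap.completion_apply_coe f.toContinuousLinearMap x

theorem complEquiv_comp {K : Type*} [SeminormedAddCommGroup K] [InnerProductSpace ℂ K]
    (f : E →ₗᵢ[ℂ] F) (g : F →ₗᵢ[ℂ] E) (hfg : ∀ y, ‖f (g y) - y‖ = 0)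
    (hgf : ∀ x, ‖g (f x) - x‖ = 0) (f' : F →ₗᵢ[ℂ] K) (g' : K →ₗᵢ[ℂ] F)
    (hfg' : ∀ y, ‖f' (g' y) - y‖ = 0) (hgf' : ∀ x, ‖g' (f' x) - x‖ = 0)
    (k : E →ₗᵢ[ℂ] K) (l : K →ₗᵢ[ℂ] E) (hkl : ∀ y, ‖k (l y) - y‖ = 0)
    (hlk : ∀ x, ‖l (k x) - x‖ = 0) (h : ∀ x, ‖f' (f x) - k x‖ = 0)
    (x : UniformSpace.Completion E) :
    complEquiv k l hkl hlk x = complEquiv f' g' hfg' hgf' (complEquiv f g hfg hgf x) := by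
  induction x using UniformSpace.Completion.induction_on with
  | hp =>
    have h1 := (complEquiv k l hkl hlk).continuous
    have h2 := (complEquiv f' g' hfg' hgf').continuous.comp (complEquiv f g hfg hgf).continuous
    exact isClosed_eq h1 h2
  | ih x =>
    rw [complEquiv_coe, complEquiv_coe, complEquiv_coe, eq_comm, ← sub_eq_zero,
      ← UniformSpace.Completion.coe_sub, ← norm_eq_zero, UniformSpace.Completion.norm_coe]
    exact h x

end Completion

section Rep

variable {X : Type u} [Groupoid.{v} X] [TopologicalSpace X] [TopologicalSpace (Arr X)]
  [MeasurableSpace X]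

/-- A homomorphism of `G` into the unitary isomorphisms between the fibres of a Hilbert bundle,
together with a quasi-invariant measure. It is a unitary representation of `G` if it is
also Borel, see `Rep.IsBorel`. -/
structure Rep (lam : HaarSystem X) (μ : Measure X) where
  quasiInvariant : QuasiInvariant lam μ
  bundle : HilbertBundle.{u, w} X
  op : ∀ {a b : X}, (a ⟶ b) → (bundle.fiber a ≃ₗᵢ[ℂ] bundle.fiber b)
  op_comp : ∀ {a b c : X} (h : a ⟶ b) (g : b ⟶ c) (x : bundle.fiber a),
    op (h ≫ g) x = op g (op h x)

namespace Rep

variable {lam : HaarSystem X} {μ : Measure X}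

/-- The bundle is a Borel Hilbert bundle and `g ↦ L_g` is Borel. -/
class IsBorel (L : Rep.{u, v, w} lam μ) : Prop where
  bundle : L.bundle.IsBorel
  measurable_op : ∀ e ∈ L.bundle.gen, ∀ f ∈ L.bundle.gen,
    Measurable fun g : Arr X => inner ℂ (f g.tgt) (L.op g.hom (e g.src))

instance (L : Rep.{u, v, w} lam μ) [L.IsBorel] : L.bundle.IsBorel := IsBorel.bundle

theorem op_id (L : Rep.{u, v, w} lam μ) {a : X} (x : L.bundle.fiber a) : L.op (𝟙 a) x = x := by
  have h := L.op_comp (𝟙 a) (𝟙 a) x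
  rw [Category.comp_id] at h
  exact ((L.op (𝟙 a)).injective h).symm

theorem op_inv_op (L : Rep.{u, v, w} lam μ) {a b : X} (g : a ⟶ b) (x : L.bundle.fiber a) :
    L.op (Groupoid.inv g) (L.op g x) = x := by
  rw [← L.op_comp, Groupoid.comp_inv, L.op_id]

theorem op_op_inv (L : Rep.{u, v, w} lam μ) {a b : X} (g : a ⟶ b) (x : L.bundle.fiber b) :
    L.op g (L.op (Groupoid.inv g) x) = x := by
  rw [← L.op_comp, Groupoid.inv_comp, L.op_id]

/-- An equivalence of representations with the same quasi-invariant measure: an isomorphism of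
Hilbert bundles, given by unitaries `U(u)` that respect Borel sections, which intertwines the
representations. -/
structure Equivalence (L : Rep.{u, v, w} lam μ) (L' : Rep.{u, v, w'} lam μ) where
  unitary : ∀ a, L.bundle.fiber a ≃ₗᵢ[ℂ] L'.bundle.fiber a
  borel : ∀ σ : ∀ a, L.bundle.fiber a,
    L.bundle.IsBorelSection σ ↔ L'.bundle.IsBorelSection fun a => unitary a (σ a)
  intertwines : ∀ {a b : X} (g : a ⟶ b) (x : L.bundle.fiber a),
    unitary b (L.op g x) = L'.op g (unitary a x)

/-- The same representation over an equivalent quasi-invariant measure. -/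
def changeMeasure (L : Rep.{u, v, w} lam μ) {μ' : Measure X} (h : QuasiInvariant lam μ')
    (_h₁ : μ ≪ μ') (_h₂ : μ' ≪ μ) : Rep.{u, v, w} lam μ' where
  quasiInvariant := h
  bundle := L.bundle
  op := L.op
  op_comp := L.op_comp

/-- The tensor product of representations. -/
def tensor (L : Rep.{u, v, w} lam μ) (L' : Rep.{u, v, w'} lam μ) :
    Rep.{u, v, max w w'} lam μ where
  quasiInvariant := L.quasiInvariant
  bundle := L.bundle.tensor L'.bundle
  op {a b} g := complEquiv (TensorProduct.mapIsometry (L.op g).toLinearIsometry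
      (L'.op g).toLinearIsometry)
    (TensorProduct.mapIsometry (L.op (Groupoid.inv g)).toLinearIsometry
      (L'.op (Groupoid.inv g)).toLinearIsometry)
    (fun y => by
      rw [norm_eq_zero, sub_eq_zero]
      induction y using TensorProduct.induction_on with
      | zero => simp
      | tmul x y => exact congrArg₂ (fun x y => x ⊗ₜ[ℂ] y) (L.op_op_inv g x) (L'.op_op_inv g y)
      | add x y hx hy => rw [map_add, map_add, hx, hy])
    (fun y => by
      rw [norm_eq_zero, sub_eq_zero]
      induction y using TensorProduct.induction_on with
      | zero => simp
      | tmul x y => exact congrArg₂ (fun x y => x ⊗ₜ[ℂ] y) (L.op_inv_op g x) (L'.op_inv_op g y)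
      | add x y hx hy => rw [map_add, map_add, hx, hy])
  op_comp h g x := by
    refine complEquiv_comp _ _ _ _ _ _ _ _ _ _ _ _ (fun y => ?_) x
    rw [norm_eq_zero, sub_eq_zero]
    induction y using TensorProduct.induction_on with
    | zero => simp
    | tmul x y => exact congrArg₂ (fun x y => x ⊗ₜ[ℂ] y) (L.op_comp h g x).symm (L'.op_comp h g y).symm
    | add x y hx hy => rw [map_add, map_add, map_add, hx, hy]

end Rep

end Rep
/-! ### Restriction and induction -/

section Induction

set_option linter.unusedSectionVars false

variable {X : Type u} [Groupoid.{v} X] [TopologicalSpace X] [TopologicalSpace (Arr X)]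

namespace ClosedSubgroupoid

variable (H : ClosedSubgroupoid X)

/-- A measure on the unit space of `G`, seen on the unit space of `H`. -/
def onUnits [MeasurableSpace X] (μ : Measure X) : Measure H.Units := μ

theorem fibMk_eq_iff {u : X} {x y : Fib u} :
    H.fibMk x = H.fibMk y ↔ ∃ h : y.src ⟶ x.src, h ∈ H.toSubgroupoid.arrows _ _ ∧
      y.hom = h ≫ x.hom :=
  ⟨fun h => Quotient.exact (s := H.fibSetoid u) h, fun h => Quotient.sound (s := H.fibSetoid u) h⟩

theorem fibMk_rep {u : X} (q : H.FibCoset u) : H.fibMk (H.rep q) = q :=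
  @Quotient.out_eq _ (H.fibSetoid u) q

theorem act_fibMk {u v : X} (g : u ⟶ v) (x : Fib u) : H.act g (H.fibMk x) = H.fibMk (x.lmul g) :=
  rfl

theorem act_comp {u v z : X} (g : u ⟶ v) (h : v ⟶ z) (q : H.FibCoset u) :
    H.act (g ≫ h) q = H.act h (H.act g q) := by
  rw [← H.fibMk_rep q]
  simp only [act_fibMk, Fib.lmul, Category.assoc]

theorem act_id {u : X} (q : H.FibCoset u) : H.act (𝟙 u) q = q := by
  rw [← H.fibMk_rep q]
  simp only [act_fibMk, Fib.lmul, Category.comp_id]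

theorem measurable_fibMk (u : X) : Measurable (H.fibMk : Fib u → H.FibCoset u) :=
  measurable_quotient_mk'' (s := H.fibSetoid u)

theorem measurable_of_fibMk {u : X} {β : Type*} [MeasurableSpace β] {f : H.FibCoset u → β}
    (hf : Measurable fun x => f (H.fibMk x)) : Measurable f :=
  (measurable_from_quotient (s := H.fibSetoid u)).2 hf

theorem measurable_cosetMk : Measurable H.cosetMk := measurable_quot_mk

theorem measurable_act [IsLCGroupoid X] {u v : X} (g : u ⟶ v) : Measurable (H.act g) :=
  H.measurable_of_fibMk ((H.measurable_fibMk v).comp (Fib.continuous_lmul g).measurable)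

theorem act_act_inv {u v : X} (g : u ⟶ v) (q : H.FibCoset v) :
    H.act g (H.act (Groupoid.inv g) q) = q := by
  rw [← act_comp, Groupoid.inv_comp, act_id]

theorem act_inv_act {u v : X} (g : u ⟶ v) (q : H.FibCoset u) :
    H.act (Groupoid.inv g) (H.act g q) = q := by
  rw [← act_comp, Groupoid.comp_inv, act_id]

/-- The action of an arrow as an isomorphism of Borel spaces. -/
def actEquiv [IsLCGroupoid X] {u v : X} (g : u ⟶ v) : H.FibCoset u ≃ᵐ H.FibCoset v where
  toFun := H.act g
  invFun := H.act (Groupoid.inv g)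
  left_inv := H.act_inv_act g
  right_inv := H.act_act_inv g
  measurable_toFun := H.measurable_act g
  measurable_invFun := H.measurable_act _

theorem measurable_anchor [IsLCGroupoid X] [MeasurableSpace X] [BorelSpace X] :
    Measurable H.anchor := by
  have h : Measurable fun g : Arr X => H.anchor (H.cosetMk g) :=
    IsLCGroupoid.continuous_tgt.measurable
  exact fun s hs => h hs

end ClosedSubgroupoid

variable [MeasurableSpace X]

/-- The restriction of a Hilbert bundle over the units of `G` to the units of `H`, which are
the same. -/
def HilbertBundle.onUnits (E : HilbertBundle.{u, w} X) (H : ClosedSubgroupoid X) :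
    HilbertBundle.{u, w} H.Units where
  fiber := E.fiber
  normedAddCommGroup := E.normedAddCommGroup
  innerProductSpace := E.innerProductSpace
  completeSpace := E.completeSpace
  gen := E.gen

instance (E : HilbertBundle.{u, w} X) (H : ClosedSubgroupoid X) [h : E.IsBorel] :
    (E.onUnits H).IsBorel where
  measurable_inner := h.measurable_inner
  exists_total := h.exists_total

/-- The restriction `L|_H`. -/
def Rep.restrict {lam : HaarSystem X} {μ : Measure X} (L : Rep.{u, v, w} lam μ)
    (H : ClosedSubgroupoid X) (beta : HaarSystem H.Units)
    (hq : QuasiInvariant beta (H.onUnits μ)) : Rep.{u, v, w} beta (H.onUnits μ) where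
  quasiInvariant := hq
  bundle := L.bundle.onUnits H
  op h := L.op (H.coeHom h)
  op_comp h g x := L.op_comp (H.coeHom h) (H.coeHom g) x

/-- A `G`-quasi-invariant probability measure `m` on `G/H` in the measure class determined by
the measure `μ` on the unit space of `H`, that is, the class of the image of
`∫ λ_u dμ(u) = (μ ∘ λ)⁻¹` in `G/H`. It comes with a decomposition `{m_u}` relative to the anchor
map `ω`, a Borel family of Radon measures on the fibres `(G/H)_u`. -/
structure InductionMeasure (lam : HaarSystem X) (H : ClosedSubgroupoid X) (μ : Measure X) where
  total : Measure H.CosetSpace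
  isProbabilityMeasure : IsProbabilityMeasure total
  total_ac : total ≪ ((lam.induced μ).map Arr.inv).map H.cosetMk
  ac_total : ((lam.induced μ).map Arr.inv).map H.cosetMk ≪ total
  fib : ∀ u, Measure (H.FibCoset u)
  finiteOnCompacts : ∀ u, IsFiniteMeasureOnCompacts (fib u)
  measurable_fib : ∀ B, MeasurableSet B → Measurable fun u => fib u (H.fibIncl u ⁻¹' B)
  total_eq : ∀ B, MeasurableSet B →
    total B = ∫⁻ u, fib u (H.fibIncl u ⁻¹' B) ∂(total.map H.anchor)
  map_act_ac : ∀ {u v : X} (g : u ⟶ v), (fib u).map (H.act g) ≪ fib v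
  ac_map_act : ∀ {u v : X} (g : u ⟶ v), fib v ≪ (fib u).map (H.act g)
  quasiInvariant : QuasiInvariant lam (total.map H.anchor)

namespace InductionMeasure

variable {lam : HaarSystem X} {H : ClosedSubgroupoid X} {μ : Measure X}

/-- The image `m̃ = ω_* m` on the unit space. -/
def base (D : InductionMeasure lam H μ) : Measure X := D.total.map H.anchor

variable [IsLCGroupoid X] [BorelSpace X]

theorem base_eq_zero_iff (D : InductionMeasure lam H μ) (hμ : QuasiInvariant lam μ) {B : Set X}
    (hB : MeasurableSet B) : D.base B = 0 ↔ μ B = 0 := by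
  have hω := H.measurable_anchor
  have hq := H.measurable_cosetMk
  have hi : Measurable (Arr.inv : Arr X → Arr X) := IsLCGroupoid.continuous_inv.measurable
  have h1 : (lam.induced μ).map Arr.inv (Arr.tgt ⁻¹' B) =
      ((lam.induced μ).map Arr.inv).map H.cosetMk (H.anchor ⁻¹' B) := by
    rw [Measure.map_apply hq (hω hB)]
    rfl
  rw [← lam.induced_tgt_eq_zero_iff μ hB, base, Measure.map_apply hω hB]
  constructor
  · intro h
    refine hμ.1 ?_
    rw [h1]
    exact D.ac_total h
  · intro h
    refine D.total_ac ?_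
    rw [← h1]
    exact hμ.2 h

theorem ac_base (D : InductionMeasure lam H μ) (hμ : QuasiInvariant lam μ) : μ ≪ D.base :=
  Measure.AbsolutelyContinuous.mk fun _ hB h => (D.base_eq_zero_iff hμ hB).1 h

theorem base_ac (D : InductionMeasure lam H μ) (hμ : QuasiInvariant lam μ) : D.base ≪ μ :=
  Measure.AbsolutelyContinuous.mk fun _ hB h => (D.base_eq_zero_iff hμ hB).2 h

theorem sigmaFinite_fib (D : InductionMeasure lam H μ) (u : X) : SigmaFinite (D.fib u) := by
  have := IsLCGroupoid.t2 (X := X)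
  have := IsLCGroupoid.locallyCompact (X := X)
  have := IsLCGroupoid.secondCountable (X := X)
  have := D.finiteOnCompacts u
  have hσ : SigmaCompactSpace (Fib u) := (Fib.isClosedEmbedding_toArr u).sigmaCompactSpace
  refine ⟨⟨⟨fun n => H.fibMk '' compactCovering (Fib u) n, fun _ => trivial, fun n => ?_, ?_⟩⟩⟩
  · have hc : Continuous (H.fibMk : Fib u → H.FibCoset u) := continuous_quot_mk
    exact ((isCompact_compactCovering (Fib u) n).image hc).measure_lt_top
  · rw [← Set.image_iUnion, iUnion_compactCovering, Set.image_univ]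
    exact Set.range_eq_univ.2 fun q => ⟨_, H.fibMk_rep q⟩

instance (D : InductionMeasure lam H μ) (u : X) : SigmaFinite (D.fib u) := D.sigmaFinite_fib u

/-- The Radon-Nikodym derivative `D(g⁻¹, ·) = d(g m_{s(g)}) / d m_{r(g)}`. -/
def deriv (D : InductionMeasure lam H μ) {u v : X} (g : u ⟶ v) : H.FibCoset v → ℝ≥0∞ :=
  ((D.fib u).map (H.act g)).rnDeriv (D.fib v)

theorem measurable_deriv (D : InductionMeasure lam H μ) {u v : X} (g : u ⟶ v) :
    Measurable (D.deriv g) := Measure.measurable_rnDeriv _ _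

theorem sigmaFinite_map (D : InductionMeasure lam H μ) {u v : X} (g : u ⟶ v) :
    SigmaFinite ((D.fib u).map (H.act g)) :=
  (H.actEquiv g).sigmaFinite_map

theorem lintegral_deriv_mul (D : InductionMeasure lam H μ) {u v : X} (g : u ⟶ v)
    {f : H.FibCoset u → ℝ≥0∞} (hf : Measurable f) :
    ∫⁻ q, D.deriv g q * f (H.act (Groupoid.inv g) q) ∂(D.fib v) = ∫⁻ q, f q ∂(D.fib u) := by
  have := D.sigmaFinite_map g
  have hf' : Measurable fun q => f (H.act (Groupoid.inv g) q) := hf.comp (H.measurable_act _)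
  rw [deriv, lintegral_rnDeriv_mul (D.map_act_ac g) hf'.aemeasurable,
    lintegral_map hf' (H.measurable_act g)]
  simp only [H.act_inv_act]

theorem deriv_lt_top (D : InductionMeasure lam H μ) {u v : X} (g : u ⟶ v) :
    ∀ᵐ q ∂(D.fib v), D.deriv g q < ∞ := by
  have := D.sigmaFinite_map g
  exact Measure.rnDeriv_lt_top _ _

theorem deriv_id (D : InductionMeasure lam H μ) (u : X) : ∀ᵐ q ∂(D.fib u), D.deriv (𝟙 u) q = 1 := by
  have h : (D.fib u).map (H.act (𝟙 u)) = D.fib u := by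
    have : H.act (𝟙 u) = id := funext H.act_id
    rw [this, Measure.map_id]
  rw [deriv, h]
  exact Measure.rnDeriv_self _

theorem deriv_comp (D : InductionMeasure lam H μ) {u v z : X} (g : u ⟶ v) (h : v ⟶ z) :
    ∀ᵐ q ∂(D.fib z), D.deriv (g ≫ h) q =
      D.deriv h q * D.deriv g (H.act (Groupoid.inv h) q) := by
  have hg := D.sigmaFinite_map g
  have hh := D.sigmaFinite_map h
  have hm : Measurable fun q => D.deriv h q * D.deriv g (H.act (Groupoid.inv h) q) :=
    (D.measurable_deriv h).mul ((D.measurable_deriv g).comp (H.measurable_act _))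
  have key : (D.fib u).map (H.act (g ≫ h)) =
      (D.fib z).withDensity fun q => D.deriv h q * D.deriv g (H.act (Groupoid.inv h) q) := by
    ext B hB
    rw [withDensity_apply _ hB, Measure.map_apply (H.measurable_act _) hB,
      ← lintegral_indicator hB]
    have e1 : (fun q => B.indicator (fun q => D.deriv h q *
        D.deriv g (H.act (Groupoid.inv h) q)) q) = fun q => D.deriv h q *
        (fun q' => D.deriv g q' * B.indicator (1 : H.FibCoset z → ℝ≥0∞) (H.act h q')) (H.act (Groupoid.inv h) q) := by
      funext q
      simp only [H.act_act_inv]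
      by_cases hq : q ∈ B <;> simp [hq]
    have hB1 : Measurable fun q' : H.FibCoset v => B.indicator (1 : H.FibCoset z → ℝ≥0∞) (H.act h q') :=
      (measurable_one.indicator hB).comp (H.measurable_act h)
    rw [e1, D.lintegral_deriv_mul h (f := fun q' => D.deriv g q' *
      B.indicator (1 : H.FibCoset z → ℝ≥0∞) (H.act h q')) ((D.measurable_deriv g).mul hB1)]
    have e2 : (fun q' => D.deriv g q' * B.indicator (1 : H.FibCoset z → ℝ≥0∞) (H.act h q')) =
        fun q' => D.deriv g q' * (fun q => B.indicator (1 : H.FibCoset z → ℝ≥0∞) (H.act h (H.act g q)))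
          (H.act (Groupoid.inv g) q') := by
      funext q'
      simp only [H.act_act_inv]
    rw [e2, D.lintegral_deriv_mul g (f := fun q =>
      B.indicator (1 : H.FibCoset z → ℝ≥0∞) (H.act h (H.act g q))) (hB1.comp (H.measurable_act g))]
    have e3 : (fun q => B.indicator (1 : H.FibCoset z → ℝ≥0∞) (H.act h (H.act g q))) =
        (H.act (g ≫ h) ⁻¹' B).indicator 1 := by
      funext q
      rw [← H.act_comp]
      rfl
    rw [e3, lintegral_indicator_one (H.measurable_act _ hB)]
  rw [deriv, key]
  exact Measure.rnDeriv_withDensity _ hm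

end InductionMeasure
namespace Rep

variable {lam : HaarSystem X} {H : ClosedSubgroupoid X} {μ : Measure X}
  {beta : HaarSystem H.Units} {ν : Measure H.Units}

/-- Sections `ξ` over `G^u` of the pull-back of the bundle of `M` along the source map, with
`ξ(xh) = M_{h⁻¹} ξ(x)` for `h` in `H`. -/
def IsEquivariant (M : Rep.{u, v, w} beta ν) {u : X} (ξ : ∀ x : Fib u, M.bundle.fiber (H.unit x.src)) :
    Prop :=
  ∀ (x : Fib u) {a : X} (h : a ⟶ x.src) (hh : h ∈ H.toSubgroupoid.arrows a x.src),
    ξ ⟨a, h ≫ x.hom⟩ = M.op (Groupoid.inv (H.mkHom h hh)) (ξ x)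

/-- Borel sections over `G^u` of the pull-back of the bundle of `M` along the source map. -/
def IsBorelOnFib (M : Rep.{u, v, w} beta ν) {u : X} (ξ : ∀ x : Fib u, M.bundle.fiber (H.unit x.src)) :
    Prop :=
  ∀ e ∈ M.bundle.gen, Measurable fun x : Fib u => inner ℂ (e (H.unit x.src)) (ξ x)

theorem IsEquivariant.norm_eq {M : Rep.{u, v, w} beta ν} {u : X}
    {ξ : ∀ x : Fib u, M.bundle.fiber (H.unit x.src)} (hξ : M.IsEquivariant ξ) (x : Fib u) :
    ‖ξ (H.rep (H.fibMk x))‖ = ‖ξ x‖ := by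
  obtain ⟨h, hh, e⟩ := (H.fibMk_eq_iff).1 (H.fibMk_rep (H.fibMk x)).symm
  have h1 := hξ x h hh
  rw [← e] at h1
  have h2 : ξ (H.rep (H.fibMk x)) = M.op (Groupoid.inv (H.mkHom h hh)) (ξ x) := h1
  rw [h2, LinearIsometryEquiv.norm_map]

theorem IsEquivariant.inner_eq {M : Rep.{u, v, w} beta ν} {u : X}
    {ξ η : ∀ x : Fib u, M.bundle.fiber (H.unit x.src)} (hξ : M.IsEquivariant ξ) (hη : M.IsEquivariant η)
    (x : Fib u) :
    inner ℂ (ξ (H.rep (H.fibMk x))) (η (H.rep (H.fibMk x))) = inner ℂ (ξ x) (η x) := by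
  obtain ⟨h, hh, e⟩ := (H.fibMk_eq_iff).1 (H.fibMk_rep (H.fibMk x)).symm
  have h1 := hξ x h hh
  have h1' := hη x h hh
  rw [← e] at h1 h1'
  have h2 : ξ (H.rep (H.fibMk x)) = M.op (Groupoid.inv (H.mkHom h hh)) (ξ x) := h1
  have h2' : η (H.rep (H.fibMk x)) = M.op (Groupoid.inv (H.mkHom h hh)) (η x) := h1'
  rw [h2, h2', LinearIsometryEquiv.inner_map_map]

section Integrals

variable [IsLCGroupoid X] [BorelSpace X]

theorem measurable_norm_rep (M : Rep.{u, v, w} beta ν) [M.bundle.IsBorel] {u : X}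
    {ξ : ∀ x : Fib u, M.bundle.fiber (H.unit x.src)} (hξ : M.IsEquivariant ξ) (hb : M.IsBorelOnFib ξ) :
    Measurable fun q : H.FibCoset u => ‖ξ (H.rep q)‖ := by
  refine H.measurable_of_fibMk ?_
  simp_rw [hξ.norm_eq]
  have hs : Measurable fun x : Fib u => H.unit x.src := (Fib.continuous_src u).measurable
  exact M.bundle.measurable_norm (p := fun x : Fib u => H.unit x.src) hs hb

theorem measurable_inner_rep (M : Rep.{u, v, w} beta ν) [M.bundle.IsBorel] {u : X}
    {ξ η : ∀ x : Fib u, M.bundle.fiber (H.unit x.src)} (hξ : M.IsEquivariant ξ) (hb : M.IsBorelOnFib ξ)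
    (hη : M.IsEquivariant η) (hb' : M.IsBorelOnFib η) :
    Measurable fun q : H.FibCoset u => inner ℂ (ξ (H.rep q)) (η (H.rep q)) := by
  refine H.measurable_of_fibMk ?_
  simp_rw [hξ.inner_eq hη]
  have hs : Measurable fun x : Fib u => H.unit x.src := (Fib.continuous_src u).measurable
  exact M.bundle.measurable_inner_of (p := fun x : Fib u => H.unit x.src) hs hb hb'

/-- The equivariant Borel sections over `G^u` that are square integrable over `(G/H)_u`. The
integrand does not depend on the choice of the representative of a coset. -/
def sqSections (M : Rep.{u, v, w} beta ν) [M.bundle.IsBorel] (D : InductionMeasure lam H μ)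
    (u : X) : Submodule ℂ (∀ x : Fib u, M.bundle.fiber (H.unit x.src)) where
  carrier := {ξ | M.IsEquivariant ξ ∧ M.IsBorelOnFib ξ ∧
    ∫⁻ q, ‖ξ (H.rep q)‖ₑ ^ 2 ∂(D.fib u) < ∞}
  zero_mem' := by
    refine ⟨fun x a h hh => ?_, fun e he => ?_, ?_⟩
    · simp only [Pi.zero_apply]
      exact (map_zero _).symm
    · simp only [Pi.zero_apply, inner_zero_right]
      exact measurable_const
    · simp
  add_mem' := by
    rintro ξ η ⟨h1, h2, h3⟩ ⟨k1, k2, k3⟩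
    refine ⟨fun x a h hh => ?_, fun e he => ?_, ?_⟩
    · simp only [Pi.add_apply, h1 x h hh, k1 x h hh]
      exact (map_add _ _ _).symm
    · simp only [Pi.add_apply, inner_add_right]
      exact (h2 e he).add (k2 e he)
    · have hm := M.measurable_norm_rep h1 h2
      have hle : ∀ q : H.FibCoset u, ‖(ξ + η) (H.rep q)‖ₑ ^ 2 ≤
          2 * ‖ξ (H.rep q)‖ₑ ^ 2 + 2 * ‖η (H.rep q)‖ₑ ^ 2 := by
        intro q
        have h := norm_add_le (ξ (H.rep q)) (η (H.rep q))
        have h' : ‖(ξ + η) (H.rep q)‖ ^ 2 ≤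
            2 * ‖ξ (H.rep q)‖ ^ 2 + 2 * ‖η (H.rep q)‖ ^ 2 := by
          have h0 := norm_nonneg (ξ (H.rep q) + η (H.rep q))
          simp only [Pi.add_apply]
          nlinarith [sq_nonneg (‖ξ (H.rep q)‖ - ‖η (H.rep q)‖)]
        simp only [← ofReal_norm]
        rw [← ENNReal.ofReal_pow (norm_nonneg _), ← ENNReal.ofReal_pow (norm_nonneg _),
          ← ENNReal.ofReal_pow (norm_nonneg _), ← ENNReal.ofReal_ofNat 2,
          ← ENNReal.ofReal_mul (by norm_num), ← ENNReal.ofReal_mul (by norm_num),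
          ← ENNReal.ofReal_add (by positivity) (by positivity)]
        exact ENNReal.ofReal_le_ofReal h'
      have hme : Measurable fun q : H.FibCoset u => ‖ξ (H.rep q)‖ₑ := by
        simp only [← ofReal_norm]
        exact hm.ennreal_ofReal
      refine (lintegral_mono hle).trans_lt ?_
      rw [lintegral_add_left ((hme.pow_const 2).const_mul 2),
        lintegral_const_mul' _ _ (by simp), lintegral_const_mul' _ _ (by simp)]
      exact ENNReal.add_lt_top.2 ⟨ENNReal.mul_lt_top (by simp) h3,
        ENNReal.mul_lt_top (by simp) k3⟩
  smul_mem' := by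
    rintro c ξ ⟨h1, h2, h3⟩
    refine ⟨fun x a h hh => ?_, fun e he => ?_, ?_⟩
    · simp only [Pi.smul_apply, h1 x h hh]
      exact (map_smul _ _ _).symm
    · simp only [Pi.smul_apply, inner_smul_right]
      exact (h2 e he).const_mul _
    · simp only [Pi.smul_apply, enorm_smul, mul_pow]
      rw [lintegral_const_mul' _ _ (by simp)]
      exact ENNReal.mul_lt_top (by simp) h3

variable (M : Rep.{u, v, w} beta ν) [M.bundle.IsBorel] (D : InductionMeasure lam H μ)

/-- The pre-Hilbert space of square integrable sections. -/
def SqSec (u : X) : Type _ := M.sqSections D u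

instance (u : X) : AddCommGroup (M.SqSec D u) := inferInstanceAs (AddCommGroup (M.sqSections D u))
instance (u : X) : Module ℂ (M.SqSec D u) := inferInstanceAs (Module ℂ (M.sqSections D u))

variable {M D} in
/-- The section underlying an element of the pre-Hilbert space. -/
def SqSec.val {u : X} (ξ : M.SqSec D u) : ∀ x : Fib u, M.bundle.fiber (H.unit x.src) :=
  (show M.sqSections D u from ξ).1

variable {M D} in
theorem SqSec.mem {u : X} (ξ : M.SqSec D u) : ξ.val ∈ M.sqSections D u :=
  (show M.sqSections D u from ξ).2

/-- A square integrable section as an element of the pre-Hilbert space. -/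
def mkSq {u : X} (ξ : ∀ x : Fib u, M.bundle.fiber (H.unit x.src)) (h : ξ ∈ M.sqSections D u) :
    M.SqSec D u := (⟨ξ, h⟩ : M.sqSections D u)

variable {M D} in
theorem SqSec.ext {u : X} {ξ η : M.SqSec D u} (h : ξ.val = η.val) : ξ = η := Subtype.ext h

theorem val_mkSq {u : X} (ξ : ∀ x : Fib u, M.bundle.fiber (H.unit x.src))
    (h : ξ ∈ M.sqSections D u) : (M.mkSq D ξ h).val = ξ := rfl

theorem val_add {u : X} (ξ η : M.SqSec D u) : (ξ + η).val = ξ.val + η.val := rfl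

theorem val_sub {u : X} (ξ η : M.SqSec D u) : (ξ - η).val = ξ.val - η.val := rfl

theorem val_smul {u : X} (c : ℂ) (ξ : M.SqSec D u) : (c • ξ).val = c • ξ.val := rfl

theorem integrable_norm_sq {u : X} (ξ : M.SqSec D u) :
    Integrable (fun q : H.FibCoset u => ‖ξ.val (H.rep q)‖ ^ 2) (D.fib u) := by
  refine ⟨((M.measurable_norm_rep ξ.mem.1 ξ.mem.2.1).pow_const 2).aestronglyMeasurable, ?_⟩
  have h := ξ.mem.2.2
  rw [hasFiniteIntegral_iff_enorm]
  simpa only [enorm_pow, enorm_norm] using h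

theorem integrable_inner {u : X} (ξ η : M.SqSec D u) :
    Integrable (fun q : H.FibCoset u => inner ℂ (ξ.val (H.rep q)) (η.val (H.rep q))) (D.fib u) := by
  refine ((M.integrable_norm_sq D ξ).add (M.integrable_norm_sq D η)).mono'
    (M.measurable_inner_rep ξ.mem.1 ξ.mem.2.1 η.mem.1 η.mem.2.1).aestronglyMeasurable
    (Filter.Eventually.of_forall fun q => ?_)
  refine (norm_inner_le_norm _ _).trans ?_
  simp only [Pi.add_apply]
  nlinarith [sq_nonneg (‖ξ.val (H.rep q)‖ - ‖η.val (H.rep q)‖), sq_nonneg ‖ξ.val (H.rep q)‖,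
    sq_nonneg ‖η.val (H.rep q)‖]

/-- The inner product `⟨ξ, η⟩ = ∫ ⟨ξ(x), η(x)⟩ dm_u(xH)`. -/
@[reducible]
def sqCore (u : X) : PreInnerProductSpace.Core ℂ (M.SqSec D u) where
  inner ξ η := ∫ q, inner ℂ (ξ.val (H.rep q)) (η.val (H.rep q)) ∂(D.fib u)
  conj_inner_symm ξ η := by
    rw [← integral_conj]
    simp only [inner_conj_symm]
  re_inner_nonneg ξ := by
    have h : (∫ q, inner ℂ (ξ.val (H.rep q)) (ξ.val (H.rep q)) ∂(D.fib u) : ℂ) =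
        ((∫ q, ‖ξ.val (H.rep q)‖ ^ 2 ∂(D.fib u) : ℝ) : ℂ) := by
      rw [← integral_complex_ofReal]
      refine integral_congr_ae (Filter.Eventually.of_forall fun q => ?_)
      simp only [inner_self_eq_norm_sq_to_K]
      simp
    rw [h]
    simp only [RCLike.re_to_complex, Complex.ofReal_re]
    exact integral_nonneg fun q => sq_nonneg _
  add_left ξ η ζ := by
    rw [← integral_add (M.integrable_inner D ξ ζ) (M.integrable_inner D η ζ)]
    simp only [val_add, Pi.add_apply, inner_add_left]
  smul_left ξ η c := by
    rw [← integral_const_mul]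
    simp only [val_smul, Pi.smul_apply, inner_smul_left]

instance (u : X) : SeminormedAddCommGroup (M.SqSec D u) :=
  @InnerProductSpace.Core.toSeminormedAddCommGroup ℂ _ _ _ _ (M.sqCore D u)

instance (u : X) : InnerProductSpace ℂ (M.SqSec D u) :=
  InnerProductSpace.ofCore (M.sqCore D u)

theorem norm_sq_eq {u : X} (ξ : M.SqSec D u) :
    ‖ξ‖ ^ 2 = ∫ q, ‖ξ.val (H.rep q)‖ ^ 2 ∂(D.fib u) := by
  have h1 : ((‖ξ‖ : ℂ)) ^ 2 = inner ℂ ξ ξ := (inner_self_eq_norm_sq_to_K (𝕜 := ℂ) ξ).symm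
  have h2 : (inner ℂ ξ ξ : ℂ) = ∫ q, inner ℂ (ξ.val (H.rep q)) (ξ.val (H.rep q)) ∂(D.fib u) := rfl
  have h : (∫ q, inner ℂ (ξ.val (H.rep q)) (ξ.val (H.rep q)) ∂(D.fib u) : ℂ) =
      ((∫ q, ‖ξ.val (H.rep q)‖ ^ 2 ∂(D.fib u) : ℝ) : ℂ) := by
    rw [← integral_complex_ofReal]
    refine integral_congr_ae (Filter.Eventually.of_forall fun q => ?_)
    simp only [inner_self_eq_norm_sq_to_K]
    simp
  rw [h2, h] at h1
  exact_mod_cast h1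

theorem norm_eq_zero_of_ae {u : X} (ξ : M.SqSec D u)
    (h : ∀ᵐ q ∂(D.fib u), ξ.val (H.rep q) = 0) : ‖ξ‖ = 0 := by
  have h1 := M.norm_sq_eq D ξ
  rw [integral_eq_zero_of_ae] at h1
  · exact pow_eq_zero_iff (two_ne_zero) |>.1 h1
  · filter_upwards [h] with q hq
    simp [hq]

theorem norm_sq_eq_toReal {u : X} (ξ : M.SqSec D u) :
    ‖ξ‖ ^ 2 = (∫⁻ q, ‖ξ.val (H.rep q)‖ₑ ^ 2 ∂(D.fib u)).toReal := by
  rw [M.norm_sq_eq, integral_eq_lintegral_of_nonneg_ae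
    (Filter.Eventually.of_forall fun q => sq_nonneg _)
    ((M.measurable_norm_rep ξ.mem.1 ξ.mem.2.1).pow_const 2).aestronglyMeasurable]
  congr 1
  refine lintegral_congr fun q => ?_
  rw [ENNReal.ofReal_pow (norm_nonneg _), ofReal_norm]

/-- `ξ ↦ (x ↦ D(g⁻¹, xH)^{1/2} ξ(g⁻¹x))` on sections. -/
def indFun {u v : X} (g : u ⟶ v) (ξ : ∀ x : Fib u, M.bundle.fiber (H.unit x.src)) (x : Fib v) :
    M.bundle.fiber (H.unit x.src) :=
  ((√(D.deriv g (H.fibMk x)).toReal : ℝ) : ℂ) • ξ ⟨x.src, x.hom ≫ Groupoid.inv g⟩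

theorem lintegral_indFun {u v : X} (g : u ⟶ v) {ξ : ∀ x : Fib u, M.bundle.fiber (H.unit x.src)}
    (h1 : M.IsEquivariant ξ) (h2 : M.IsBorelOnFib ξ) :
    ∫⁻ q, ‖M.indFun D g ξ (H.rep q)‖ₑ ^ 2 ∂(D.fib v) =
      ∫⁻ q, ‖ξ (H.rep q)‖ₑ ^ 2 ∂(D.fib u) := by
  have hme : Measurable fun q : H.FibCoset u => ‖ξ (H.rep q)‖ₑ ^ 2 := by
    simp only [← ofReal_norm]
    exact (M.measurable_norm_rep h1 h2).ennreal_ofReal.pow_const 2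
  rw [← D.lintegral_deriv_mul g hme]
  refine lintegral_congr_ae ?_
  filter_upwards [D.deriv_lt_top g] with q hq
  have hact : H.act (Groupoid.inv g) q = H.fibMk ((H.rep q).lmul (Groupoid.inv g)) := by
    rw [← H.act_fibMk, H.fibMk_rep]
  have hn : ‖ξ (H.rep (H.act (Groupoid.inv g) q))‖ₑ =
      ‖ξ ⟨(H.rep q).src, (H.rep q).hom ≫ Groupoid.inv g⟩‖ₑ := by
    rw [hact, Fib.lmul, ← ofReal_norm, ← ofReal_norm, h1.norm_eq]
  rw [hn, indFun, H.fibMk_rep, enorm_smul, mul_pow]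
  congr 1
  rw [← ofReal_norm, Complex.norm_real, Real.norm_of_nonneg (Real.sqrt_nonneg _),
    ← ENNReal.ofReal_pow (Real.sqrt_nonneg _), Real.sq_sqrt ENNReal.toReal_nonneg,
    ENNReal.ofReal_toReal hq.ne]

theorem indFun_mem {u v : X} (g : u ⟶ v) (ξ : M.SqSec D u) :
    M.indFun D g ξ.val ∈ M.sqSections D v := by
  refine ⟨fun x a h hh => ?_, fun e he => ?_, ?_⟩
  · have h1 : H.fibMk (⟨a, h ≫ x.hom⟩ : Fib v) = H.fibMk x :=
      ((H.fibMk_eq_iff).2 ⟨h, hh, rfl⟩).symm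
    have h2 := ξ.mem.1 ⟨x.src, x.hom ≫ Groupoid.inv g⟩ h hh
    have h3 : ∀ f : a ⟶ u, f = h ≫ x.hom ≫ Groupoid.inv g →
        ξ.val ⟨a, f⟩ = ξ.val ⟨a, h ≫ x.hom ≫ Groupoid.inv g⟩ := by
      rintro _ rfl
      rfl
    simp only [indFun, h1]
    rw [h3 ((h ≫ x.hom) ≫ Groupoid.inv g) (Category.assoc _ _ _), h2]
    exact (map_smul _ _ _).symm
  · simp only [indFun, inner_smul_right]
    refine Measurable.mul (M := ℂ) ?_ ?_
    · exact Complex.measurable_ofReal.comp (((D.measurable_deriv g).comp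
        (H.measurable_fibMk v)).ennreal_toReal.sqrt)
    · exact (ξ.mem.2.1 e he).comp (Fib.continuous_lmul (Groupoid.inv g)).measurable
  · rw [M.lintegral_indFun D g ξ.mem.1 ξ.mem.2.1]
    exact ξ.mem.2.2

/-- The operator `(Ind M)_g` on square integrable sections. -/
def indPre {u v : X} (g : u ⟶ v) : M.SqSec D u →ₗᵢ[ℂ] M.SqSec D v where
  toFun ξ := M.mkSq D (M.indFun D g ξ.val) (M.indFun_mem D g ξ)
  map_add' ξ η := SqSec.ext (funext fun x => smul_add _ _ _)
  map_smul' c ξ := SqSec.ext (funext fun x => smul_comm (M := ℂ) (N := ℂ) _ _ (ξ.val _))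
  norm_map' ξ := by
    have h : ‖(M.mkSq D (M.indFun D g ξ.val) (M.indFun_mem D g ξ) : M.SqSec D v)‖ ^ 2 = ‖ξ‖ ^ 2 := by
      rw [M.norm_sq_eq_toReal, M.norm_sq_eq_toReal, val_mkSq, M.lintegral_indFun D g ξ.mem.1 ξ.mem.2.1]
    exact (pow_left_inj₀ (norm_nonneg _) (norm_nonneg _) two_ne_zero).1 h

theorem val_indPre {u v : X} (g : u ⟶ v) (ξ : M.SqSec D u) :
    (M.indPre D g ξ).val = M.indFun D g ξ.val := rfl

theorem indPre_comp {u v z : X} (g : u ⟶ v) (h : v ⟶ z) (ξ : M.SqSec D u) :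
    ‖M.indPre D h (M.indPre D g ξ) - M.indPre D (g ≫ h) ξ‖ = 0 := by
  refine M.norm_eq_zero_of_ae D _ ?_
  filter_upwards [D.deriv_comp g h] with q hq
  have hact : H.fibMk ⟨(H.rep q).src, (H.rep q).hom ≫ Groupoid.inv h⟩ =
      H.act (Groupoid.inv h) q := by
    conv_rhs => rw [← H.fibMk_rep q]
    rfl
  have hξ : ∀ f : (H.rep q).src ⟶ u, f = (H.rep q).hom ≫ Groupoid.inv (g ≫ h) →
      ξ.val ⟨(H.rep q).src, f⟩ =
        ξ.val ⟨(H.rep q).src, (H.rep q).hom ≫ Groupoid.inv (g ≫ h)⟩ := by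
    rintro _ rfl
    rfl
  have hξ' := hξ (((H.rep q).hom ≫ Groupoid.inv h) ≫ Groupoid.inv g) (by simp)
  rw [val_sub, Pi.sub_apply, sub_eq_zero, val_indPre, val_indPre, val_indPre]
  simp only [indFun, H.fibMk_rep, hq, hact]
  rw [hξ', smul_smul, ENNReal.toReal_mul, Real.sqrt_mul ENNReal.toReal_nonneg, Complex.ofReal_mul]

theorem indPre_id {u : X} (ξ : M.SqSec D u) : ‖M.indPre D (𝟙 u) ξ - ξ‖ = 0 := by
  refine M.norm_eq_zero_of_ae D _ ?_
  filter_upwards [D.deriv_id u] with q hq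
  have hξ : ∀ f : (H.rep q).src ⟶ u, f = (H.rep q).hom → ξ.val ⟨(H.rep q).src, f⟩ =
      ξ.val (H.rep q) := by
    rintro _ rfl
    rfl
  have hξ' := hξ ((H.rep q).hom ≫ Groupoid.inv (𝟙 u)) (by simp)
  rw [val_sub, Pi.sub_apply, sub_eq_zero, val_indPre]
  simp only [indFun, H.fibMk_rep, hq]
  rw [hξ']
  simp

theorem indPre_inv {u v : X} (g : u ⟶ v) (ξ : M.SqSec D u) :
    ‖M.indPre D (Groupoid.inv g) (M.indPre D g ξ) - ξ‖ = 0 := by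
  have h1 := M.indPre_comp D g (Groupoid.inv g) ξ
  have h2 := M.indPre_id D ξ
  rw [Groupoid.comp_inv] at h1
  refine le_antisymm ?_ (norm_nonneg _)
  calc _ ≤ _ := norm_sub_le_norm_sub_add_norm_sub _ (M.indPre D (𝟙 u) ξ) _
    _ = 0 := by rw [h1, h2, add_zero]

theorem indPre_inv' {u v : X} (g : u ⟶ v) (ξ : M.SqSec D v) :
    ‖M.indPre D g (M.indPre D (Groupoid.inv g) ξ) - ξ‖ = 0 := by
  have h1 := M.indPre_comp D (Groupoid.inv g) g ξ
  have h2 := M.indPre_id D ξ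
  rw [Groupoid.inv_comp] at h1
  refine le_antisymm ?_ (norm_nonneg _)
  calc _ ≤ _ := norm_sub_le_norm_sub_add_norm_sub _ (M.indPre D (𝟙 v) ξ) _
    _ = 0 := by rw [h1, h2, add_zero]

/-- The bundle of the induced representation. Its fibre at `u` is the Hilbert space
`L²((G/H)_u, m_u)` of equivariant sections over `G^u`. Its Borel structure is determined by the
equivariant Borel sections over `G` that are square integrable over each `(G/H)_u`. -/
def indBundle : HilbertBundle.{u, max u v w} X where
  fiber u := UniformSpace.Completion (M.SqSec D u)
  gen := {σ | ∃ ζ : ∀ g : Arr X, M.bundle.fiber (H.unit g.src),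
    (∀ e ∈ M.bundle.gen, Measurable fun g : Arr X => inner ℂ (e (H.unit g.src)) (ζ g)) ∧
    ∃ h : ∀ u : X, (fun x : Fib u => ζ x.toArr) ∈ M.sqSections D u,
      ∀ u, σ u = (M.mkSq D _ (h u) : UniformSpace.Completion (M.SqSec D u))}

/-- The induced representation `Ind_H^G M`, over the measure `m̃`. -/
def ind : Rep.{u, v, max u v w} lam D.base where
  quasiInvariant := D.quasiInvariant
  bundle := M.indBundle D
  op g := complEquiv (M.indPre D g) (M.indPre D (Groupoid.inv g)) (M.indPre_inv' D g)
    (M.indPre_inv D g)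
  op_comp h g x := complEquiv_comp _ _ _ _ _ _ _ _ _ _ _ _ (M.indPre_comp D h g) x

/-- The vector of the fibre of `Ind_H^G M` at `u` given by a section. -/
def indVec {u : X} (ξ : M.SqSec D u) : (M.ind D).bundle.fiber u :=
  (ξ : UniformSpace.Completion (M.SqSec D u))

end Integrals

end Rep

/-! ### Restrictions and tensor products of unitary representations are unitary representations -/

namespace Rep

variable {lam : HaarSystem X} {μ : Measure X}

instance isBorel_changeMeasure (L : Rep.{u, v, w} lam μ) [hL : L.IsBorel] {μ' : Measure X}
    (h : QuasiInvariant lam μ') (h₁ : μ ≪ μ') (h₂ : μ' ≪ μ) :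
    (L.changeMeasure h h₁ h₂).IsBorel where
  bundle := hL.bundle
  measurable_op := hL.measurable_op

instance isBorel_restrict (L : Rep.{u, v, w} lam μ) [hL : L.IsBorel] (H : ClosedSubgroupoid X)
    (beta : HaarSystem H.Units) (hq : QuasiInvariant beta (H.onUnits μ)) :
    (L.restrict H beta hq).IsBorel where
  bundle := inferInstanceAs (L.bundle.onUnits H).IsBorel
  measurable_op e he f hf := by
    have hc : Continuous H.incl := continuous_induced_dom
    exact (hL.measurable_op e he f hf).comp hc.measurable

instance isBorel_tensor (L : Rep.{u, v, w} lam μ)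
    (L' : Rep.{u, v, w'} lam μ) [hL : L.IsBorel] [hL' : L'.IsBorel] : (L.tensor L').IsBorel where
  bundle := inferInstanceAs (L.bundle.tensor L'.bundle).IsBorel
  measurable_op := by
    rintro σ ⟨e, he, f, hf, hσ⟩ τ ⟨e', he', f', hf', hτ⟩
    have h := (hL.measurable_op e he e' he').mul (hL'.measurable_op f hf f' hf')
    have heq : (fun g : Arr X => inner ℂ (τ g.tgt) ((L.tensor L').op g.hom (σ g.src))) =
        fun g : Arr X => inner ℂ (e' g.tgt) (L.op g.hom (e g.src)) *
          inner ℂ (f' g.tgt) (L'.op g.hom (f g.src)) := by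
      funext g
      rw [hσ, hτ]
      have h1 : (L.tensor L').op g.hom (L.bundle.tmul L'.bundle (e g.src) (f g.src)) =
          L.bundle.tmul L'.bundle (L.op g.hom (e g.src)) (L'.op g.hom (f g.src)) :=
        ContinuousLinearMap.completion_apply_coe _ _
      exact (congrArg _ h1).trans (HilbertBundle.inner_tmul_tmul _ _ _ _ _ _)
    rw [heq]
    exact h

end Rep

end Induction
end TopGpd

end

/-!
On the fibre at `u`, the formula `ξ ⊗ η ↦ (x ↦ L_{x⁻¹} ξ ⊗ η(x))` multiplies inner products, because
each `L_{x⁻¹}` is unitary, and the section on the right is equivariant, Borel and square integrable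
whenever `η` is. Hence it extends to an isometry of the Hilbert space tensor product, and it
commutes with the actions of `G` because `L_{x⁻¹} L_g = L_{(g⁻¹x)⁻¹}`, while the factor
`D(g⁻¹, xH)^{1/2}` is the same on both sides. What needs an argument is that the isometry is onto and
that it respects the Borel structures in both directions.

Both follow from one expansion. Let `ζ` be a square integrable equivariant section for `L|_H ⊗ M`.
For `ξ` in the fibre of `L` at `u`, the partial inner product `x ↦ ⟨L_{x⁻¹} ξ, ζ(x)⟩` is a square
integrable equivariant section for `M`. If `(eᵢ)` is a total sequence in the fibre of
`L` that is orthonormal up to zeros, then so is `(L_{x⁻¹} eᵢ)` for every `x`, and therefore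
`ζ(x) = ∑ᵢ L_{x⁻¹} eᵢ ⊗ ⟨L_{x⁻¹} eᵢ, ζ(x)⟩`. The partial sums are orthogonal projections of `ζ(x)`, so
by dominated convergence the series also converges in the Hilbert space of sections
(`Rep.tendsto_sum_tensorSq_contractSq`). Its terms lie in the image of the isometry, which gives
surjectivity (`Rep.exists_unitary`).

For the Borel structures, the `eᵢ` are chosen as Borel sections of the bundle of `L`, by applying the
Gram-Schmidt process to a fibrewise total sequence
(`HilbertBundle.exists_isTotalOrthonormalOrZero`). The expansion then writes every section that tests
Borel measurability in the bundle of `Ind (L|_H ⊗ M)` as a pointwise limit of sums of images of Borel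
sections which test it in the bundle of `L ⊗ Ind M` (`Rep.isBorelSection_unitary_iff`). No
separability of the bundle of `Ind M` is needed.
-/

noncomputable section

namespace TopGpd

/-! ### Extension of isometries to Hilbert space tensor products -/

section Extension

/-- A linear map on a pre-Hilbert space that preserves inner products and has dense range extends
to a unitary on the completion. -/
theorem exists_isometryEquiv_completion {V Q : Type*} [SeminormedAddCommGroup V]
    [InnerProductSpace ℂ V] [NormedAddCommGroup Q] [InnerProductSpace ℂ Q] [CompleteSpace Q]
    (f : V →ₗ[ℂ] Q) (hf : ∀ x y, inner ℂ (f x) (f y) = inner ℂ x y) (hd : DenseRange f) :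
    ∃ U : UniformSpace.Completion V ≃ₗᵢ[ℂ] Q, ∀ x : V, U (x : UniformSpace.Completion V) = f x := by
  have hn : ∀ x, ‖f x‖ = ‖x‖ := (f.isometryOfInner hf).norm_map
  let ι : V →L[ℂ] UniformSpace.Completion V := UniformSpace.Completion.toComplL
  have hι : DenseRange ι := UniformSpace.Completion.denseRange_coe
  have hb : ∀ x, ‖f x‖ ≤ 1 * ‖ι x‖ := fun x => by
    rw [hn, one_mul]
    exact (UniformSpace.Completion.norm_coe x).ge
  have he : ∀ x : V, f.extendOfNorm ι.toLinearMap (x : UniformSpace.Completion V) = f x :=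
    fun x => f.extendOfNorm_eq hι ⟨1, hb⟩ x
  let T : UniformSpace.Completion V →ₗᵢ[ℂ] Q :=
    { (f.extendOfNorm ι.toLinearMap).toLinearMap with
      norm_map' := fun x => by
        change ‖f.extendOfNorm ι.toLinearMap x‖ = ‖x‖
        induction x using UniformSpace.Completion.induction_on with
        | hp => exact isClosed_eq (by fun_prop) (by fun_prop)
        | ih x => rw [he, hn, UniformSpace.Completion.norm_coe] }
  have hT : ∀ x : V, T (x : UniformSpace.Completion V) = f x := he
  have hs : Function.Surjective T := by
    have hd' : DenseRange T := hd.mono (by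
      rintro _ ⟨x, rfl⟩
      exact ⟨_, hT x⟩)
    have hc : IsClosed (Set.range T) := T.isometry.isUniformInducing.isComplete_range.isClosed
    rw [← Set.range_eq_univ, ← hc.closure_eq]
    exact hd'.closure_range
  exact ⟨LinearIsometryEquiv.ofSurjective T hs, hT⟩

theorem inner_completion_eq {P Q : Type*} [SeminormedAddCommGroup P] [InnerProductSpace ℂ P]
    [NormedAddCommGroup Q] [InnerProductSpace ℂ Q] (S T : UniformSpace.Completion P →L[ℂ] Q)
    (c : ℂ) (h : ∀ p q : P, inner ℂ (S p) (T q) = c * inner ℂ p q)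
    (p q : UniformSpace.Completion P) : inner ℂ (S p) (T q) = c * inner ℂ p q := by
  induction p using UniformSpace.Completion.induction_on with
  | hp =>
    exact isClosed_eq (S.continuous.inner continuous_const)
      (continuous_const.mul (continuous_id.inner continuous_const))
  | ih p =>
    induction q using UniformSpace.Completion.induction_on with
    | hp =>
      exact isClosed_eq (continuous_const.inner T.continuous)
        (continuous_const.mul (continuous_const.inner continuous_id))
    | ih q => rw [h, UniformSpace.Completion.inner_coe]

/-- A bilinear map `b` on `E × P` with values in a pre-Hilbert space which multiplies inner
products, and for which the span of the values `b x p` is dense, extends to a unitary on the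
Hilbert space tensor product of `E` and the completion of `P`. -/
theorem exists_isometryEquiv_completion_tensor {E P P' : Type*} [NormedAddCommGroup E]
    [InnerProductSpace ℂ E] [SeminormedAddCommGroup P] [InnerProductSpace ℂ P]
    [SeminormedAddCommGroup P'] [InnerProductSpace ℂ P'] (b : E →ₗ[ℂ] P →ₗ[ℂ] P')
    (hb : ∀ x p y q, inner ℂ (b x p) (b y q) = inner ℂ x y * inner ℂ p q)
    (hd : Dense (Submodule.span ℂ (Set.range fun r : E × P =>
      (b r.1 r.2 : UniformSpace.Completion P')) : Set (UniformSpace.Completion P'))) :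
    ∃ U : UniformSpace.Completion (E ⊗[ℂ] UniformSpace.Completion P) ≃ₗᵢ[ℂ]
        UniformSpace.Completion P', ∀ (x : E) (p : P),
      U ((x ⊗ₜ[ℂ] (p : UniformSpace.Completion P) : E ⊗[ℂ] UniformSpace.Completion P) :
        UniformSpace.Completion (E ⊗[ℂ] UniformSpace.Completion P)) = (b x p : P') := by
  have hn : ∀ x p, ‖b x p‖ ≤ ‖x‖ * ‖p‖ := by
    intro x p
    have h := hb x p x p
    simp only [inner_self_eq_norm_sq_to_K, ← mul_pow] at h
    have h' : ‖b x p‖ ^ 2 = (‖x‖ * ‖p‖) ^ 2 := by exact_mod_cast h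
    exact ((pow_left_inj₀ (norm_nonneg _) (by positivity) two_ne_zero).1 h').le
  let B : E → UniformSpace.Completion P →L[ℂ] UniformSpace.Completion P' := fun x =>
    ((b x).mkContinuous ‖x‖ (hn x)).completion
  have hB : ∀ (x : E) (p : P), B x (p : UniformSpace.Completion P) = (b x p : P') := fun x p =>
    ContinuousLinearMap.completion_apply_coe _ p
  let B' : E →ₗ[ℂ] UniformSpace.Completion P →ₗ[ℂ] UniformSpace.Completion P' :=
    LinearMap.mk₂ ℂ (fun x p => B x p)
      (fun x y p => by
        induction p using UniformSpace.Completion.induction_on with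
        | hp => exact isClosed_eq (B _).continuous ((B _).continuous.add (B _).continuous)
        | ih p =>
          rw [hB, hB, hB, map_add, LinearMap.add_apply, UniformSpace.Completion.coe_add])
      (fun c x p => by
        induction p using UniformSpace.Completion.induction_on with
        | hp => exact isClosed_eq (B _).continuous ((B _).continuous.const_smul c)
        | ih p =>
          rw [hB, hB, map_smul, LinearMap.smul_apply, UniformSpace.Completion.coe_smul])
      (fun x p q => map_add _ _ _) (fun c x p => map_smul _ _ _)
  have hB' : ∀ x p, B' x p = B x p := fun x p => rfl
  have hi : ∀ x p y q, inner ℂ (B' x p) (B' y q) = inner ℂ x y * inner ℂ p q := by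
    intro x p y q
    refine inner_completion_eq (B x) (B y) _ (fun p q => ?_) p q
    rw [hB, hB, UniformSpace.Completion.inner_coe, hb]
  let f : E ⊗[ℂ] UniformSpace.Completion P →ₗ[ℂ] UniformSpace.Completion P' :=
    TensorProduct.lift B'
  have hf : ∀ x p, f (x ⊗ₜ[ℂ] p) = B' x p := fun x p => TensorProduct.lift.tmul x p
  have hfi : ∀ r s, inner ℂ (f r) (f s) = inner ℂ r s := by
    intro r s
    induction r using TensorProduct.induction_on with
    | zero => simp
    | add r r' h h' => rw [map_add, inner_add_left, inner_add_left, h, h']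
    | tmul x p =>
      induction s using TensorProduct.induction_on with
      | zero => simp
      | add r r' h h' => rw [map_add, inner_add_right, inner_add_right, h, h']
      | tmul y q => rw [hf, hf, hi, TensorProduct.inner_tmul]
  have hfd : DenseRange f := by
    refine Dense.mono ?_ hd
    rw [← LinearMap.coe_range]
    refine Submodule.span_le.2 ?_
    rintro _ ⟨⟨x, p⟩, rfl⟩
    exact ⟨x ⊗ₜ[ℂ] (p : UniformSpace.Completion P), (hf _ _).trans (hB x p)⟩
  obtain ⟨U, hU⟩ := exists_isometryEquiv_completion f hfi hfd
  exact ⟨U, fun x p => by rw [hU, hf, hB', hB]⟩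

end Extension

/-! ### Partial inner products -/

/-- A total sequence whose members are pairwise orthogonal and of norm `1` or `0`: the form in which
Gram-Schmidt orthonormalisation returns a sequence that may be linearly dependent. -/
structure IsTotalOrthonormalOrZero {E : Type*} [NormedAddCommGroup E] [InnerProductSpace ℂ E]
    (e : ℕ → E) : Prop where
  inner_eq_zero : ∀ i j, i ≠ j → inner ℂ (e i) (e j) = 0
  norm_eq : ∀ i, e i = 0 ∨ ‖e i‖ = 1
  dense_span : Dense (Submodule.span ℂ (Set.range e) : Set E)

theorem IsTotalOrthonormalOrZero.map {E E' : Type*} [NormedAddCommGroup E] [InnerProductSpace ℂ E]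
    [NormedAddCommGroup E'] [InnerProductSpace ℂ E'] {e : ℕ → E} (he : IsTotalOrthonormalOrZero e)
    (A : E ≃ₗᵢ[ℂ] E') : IsTotalOrthonormalOrZero fun i => A (e i) where
  inner_eq_zero i j h := by rw [A.inner_map_map, he.inner_eq_zero i j h]
  norm_eq i := by
    rw [A.norm_map]
    exact (he.norm_eq i).imp (fun h => by rw [h, map_zero]) id
  dense_span := by
    have h := A.surjective.denseRange.dense_image A.continuous he.dense_span
    refine h.mono ?_
    rintro _ ⟨x, hx, rfl⟩
    have h1 : A x ∈ (Submodule.span ℂ (Set.range e)).map A.toLinearEquiv.toLinearMap :=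
      ⟨x, hx, rfl⟩
    rw [Submodule.map_span, ← Set.range_comp] at h1
    exact h1

section PartialInner

variable {E F W : Type*} [NormedAddCommGroup E] [InnerProductSpace ℂ E]
  [NormedAddCommGroup F] [InnerProductSpace ℂ F] [CompleteSpace F]
  [NormedAddCommGroup W] [InnerProductSpace ℂ W] [CompleteSpace W]
  (t : E →ₗ[ℂ] F →ₗ[ℂ] W)
  (ht : ∀ x y x' y', inner ℂ (t x y) (t x' y') = inner ℂ x x' * inner ℂ y y')

/-- The partial inner product `z ↦ ⟨x, z⟩`, the adjoint of `y ↦ x ⊗ y`. Here `t` plays the role of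
the map `(x, y) ↦ x ⊗ y` into the Hilbert space tensor product. -/
def partialInner (x : E) : W →L[ℂ] F :=
  ContinuousLinearMap.adjoint ((t x).mkContinuous ‖x‖ fun y => by
    have h := ht x y x y
    simp only [inner_self_eq_norm_sq_to_K, ← mul_pow] at h
    have h' : ‖t x y‖ ^ 2 = (‖x‖ * ‖y‖) ^ 2 := by exact_mod_cast h
    exact ((pow_left_inj₀ (norm_nonneg _) (by positivity) two_ne_zero).1 h').le)

theorem inner_partialInner (x : E) (y : F) (z : W) :
    inner ℂ y (partialInner t ht x z) = inner ℂ (t x y) z :=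
  ContinuousLinearMap.adjoint_inner_right _ _ _

theorem partialInner_apply_apply (x x' : E) (y : F) :
    partialInner t ht x (t x' y) = (inner ℂ x x' : ℂ) • y := by
  refine ext_inner_left ℂ fun k => ?_
  rw [inner_partialInner, ht, inner_smul_right]

theorem norm_partialInner_le (x : E) (z : W) : ‖partialInner t ht x z‖ ≤ ‖x‖ * ‖z‖ := by
  refine (ContinuousLinearMap.le_opNorm _ _).trans ?_
  gcongr
  rw [partialInner, LinearIsometryEquiv.norm_map]
  exact LinearMap.mkContinuous_norm_le _ (norm_nonneg _) _

/-- The partial sums of the expansion of a vector of a tensor product along an orthonormal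
sequence in the first factor. -/
def partialExpansion (e : ℕ → E) (n : ℕ) (z : W) : W :=
  ∑ i ∈ Finset.range n, t (e i) (partialInner t ht (e i) z)

variable {e : ℕ → E}

theorem partialExpansion_sub (n : ℕ) (z z' : W) : partialExpansion t ht e n (z - z') =
    partialExpansion t ht e n z - partialExpansion t ht e n z' := by
  simp only [partialExpansion, map_sub, Finset.sum_sub_distrib]

theorem partialExpansion_apply (he : IsTotalOrthonormalOrZero e) {i n : ℕ} (hi : i < n) (y : F) :
    partialExpansion t ht e n (t (e i) y) = t (e i) y := by
  rw [partialExpansion, Finset.sum_eq_single_of_mem i (Finset.mem_range.2 hi)]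
  · rw [partialInner_apply_apply]
    rcases he.norm_eq i with h | h
    · rw [h, map_zero, LinearMap.zero_apply, LinearMap.zero_apply]
    · rw [inner_self_eq_norm_sq_to_K, h]
      simp
  · intro j _ hj
    rw [partialInner_apply_apply, he.inner_eq_zero j i hj, zero_smul, map_zero]

/-- The partial expansions are orthogonal projections. -/
theorem norm_sub_partialExpansion_le (he : IsTotalOrthonormalOrZero e) (n : ℕ) (z : W) :
    ‖z - partialExpansion t ht e n z‖ ≤ ‖z‖ := by
  set c : ℕ → F := fun i => partialInner t ht (e i) z with hc
  have h1 : inner ℂ (partialExpansion t ht e n z) z =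
      ∑ i ∈ Finset.range n, inner ℂ (c i) (c i) := by
    rw [partialExpansion, sum_inner]
    exact Finset.sum_congr rfl fun i _ => (inner_partialInner t ht _ _ _).symm
  have h2 : inner ℂ (partialExpansion t ht e n z) (partialExpansion t ht e n z) =
      ∑ i ∈ Finset.range n, inner ℂ (c i) (c i) := by
    rw [partialExpansion, sum_inner]
    refine Finset.sum_congr rfl fun i hi => ?_
    rw [inner_sum, Finset.sum_eq_single_of_mem i hi]
    · rw [ht]
      rcases he.norm_eq i with h | h
      · have h0 : c i = 0 := norm_le_zero_iff.1 ((norm_partialInner_le t ht _ _).trans (by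
          rw [h, norm_zero, zero_mul]))
        change _ * inner ℂ (c i) (c i) = _
        simp [h0]
      · rw [inner_self_eq_norm_sq_to_K, h]
        simp [hc]
    · intro j _ hj
      rw [ht, he.inner_eq_zero i j hj.symm, zero_mul]
  have h3 : inner ℂ (partialExpansion t ht e n z) (z - partialExpansion t ht e n z) = 0 := by
    rw [inner_sub_right, h1, h2, sub_self]
  have h4 := norm_add_sq_eq_norm_sq_add_norm_sq_of_inner_eq_zero _ _ h3
  rw [add_sub_cancel] at h4
  nlinarith [norm_nonneg z, norm_nonneg (z - partialExpansion t ht e n z),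
    mul_self_nonneg ‖partialExpansion t ht e n z‖]

theorem tendsto_partialExpansion (he : IsTotalOrthonormalOrZero e)
    (hd : Dense (Submodule.span ℂ (Set.image2 (fun x y => t x y) (Set.range e) Set.univ) : Set W))
    (z : W) : Filter.Tendsto (fun n => partialExpansion t ht e n z) Filter.atTop (𝓝 z) := by
  have hfix : ∀ w ∈ Submodule.span ℂ (Set.image2 (fun x y => t x y) (Set.range e) Set.univ),
      ∃ N, ∀ n ≥ N, w - partialExpansion t ht e n w = 0 := by
    intro w hw
    induction hw using Submodule.span_induction with
    | mem w hw =>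
      obtain ⟨_, ⟨i, rfl⟩, y, -, rfl⟩ := hw
      exact ⟨i + 1, fun n hn => by rw [partialExpansion_apply t ht he (by omega), sub_self]⟩
    | zero => exact ⟨0, fun n _ => by simp [partialExpansion]⟩
    | add w w' _ _ h h' =>
      obtain ⟨N, hN⟩ := h
      obtain ⟨N', hN'⟩ := h'
      refine ⟨max N N', fun n hn => ?_⟩
      have e1 := hN n (le_trans (le_max_left _ _) hn)
      have e2 := hN' n (le_trans (le_max_right _ _) hn)
      simp only [partialExpansion, map_add, Finset.sum_add_distrib] at e1 e2 ⊢
      rw [add_sub_add_comm, e1, e2, add_zero]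
    | smul a w _ h =>
      obtain ⟨N, hN⟩ := h
      refine ⟨N, fun n hn => ?_⟩
      have e1 := hN n hn
      simp only [partialExpansion, map_smul, ← Finset.smul_sum] at e1 ⊢
      rw [← smul_sub, e1, smul_zero]
  refine Metric.tendsto_atTop.2 fun ε hε => ?_
  obtain ⟨w, hw, hwz⟩ := Metric.mem_closure_iff.1 (hd z) ε hε
  obtain ⟨N, hN⟩ := hfix w hw
  refine ⟨N, fun n hn => ?_⟩
  have h := norm_sub_partialExpansion_le t ht he n (z - w)
  rw [partialExpansion_sub, sub_sub_sub_comm, hN n hn, sub_zero] at h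
  rw [dist_comm, dist_eq_norm]
  rw [dist_eq_norm] at hwz
  exact h.trans_lt hwz

end PartialInner

/-! ### Borel orthonormalisation -/

theorem isTotalOrthonormalOrZero_gramSchmidtNormed {E : Type*} [NormedAddCommGroup E]
    [InnerProductSpace ℂ E] {a : ℕ → E} (ha : Dense (Submodule.span ℂ (Set.range a) : Set E)) :
    IsTotalOrthonormalOrZero (InnerProductSpace.gramSchmidtNormed ℂ a) where
  inner_eq_zero i j h := by
    simp [InnerProductSpace.gramSchmidtNormed, InnerProductSpace.gramSchmidt_orthogonal ℂ a h]
  norm_eq i := or_iff_not_imp_left.2 InnerProductSpace.gramSchmidtNormed_unit_length'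
  dense_span := by
    rwa [InnerProductSpace.span_gramSchmidtNormed_range, InnerProductSpace.span_gramSchmidt]

namespace HilbertBundle

variable {X : Type u} [MeasurableSpace X]

theorem IsBorelSection.measurable_inner {E : HilbertBundle.{u, w} X} [E.IsBorel]
    {σ τ : ∀ u, E.fiber u} (hσ : E.IsBorelSection σ) (hτ : E.IsBorelSection τ) :
    Measurable fun u => inner ℂ (σ u) (τ u) :=
  E.measurable_inner_of measurable_id hσ hτ

namespace IsBorelSection

variable {E : HilbertBundle.{u, w} X}

theorem of_mem_gen [E.IsBorel] {e : ∀ u, E.fiber u} (he : e ∈ E.gen) : E.IsBorelSection e :=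
  fun f hf => IsBorel.measurable_inner f hf e he

theorem zero : E.IsBorelSection 0 := fun f _ => by
  simp only [Pi.zero_apply, inner_zero_right]
  exact measurable_const

theorem add {s t : ∀ u, E.fiber u} (hs : E.IsBorelSection s) (ht : E.IsBorelSection t) :
    E.IsBorelSection (s + t) := fun f hf => by
  simp only [Pi.add_apply, inner_add_right]
  exact (hs f hf).add (ht f hf)

theorem smul {c : X → ℂ} (hc : Measurable c) {s : ∀ u, E.fiber u} (hs : E.IsBorelSection s) :
    E.IsBorelSection fun u => c u • s u := fun f hf => by
  simp only [inner_smul_right]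
  exact hc.mul (hs f hf)

end IsBorelSection

/-- A Borel Hilbert bundle has a sequence of sections which is fibrewise total and orthonormal, up
to zeros. The sections can be taken in any module over the Borel functions that consists of
Borel sections and contains the determining ones, since the Gram-Schmidt process only uses Borel
coefficients. -/
theorem exists_isTotalOrthonormalOrZero (E : HilbertBundle.{u, w} X) [E.IsBorel]
    (S : Set (∀ u, E.fiber u)) (hS : ∀ s ∈ S, E.IsBorelSection s) (hgen : E.gen ⊆ S)
    (hzero : 0 ∈ S) (hadd : ∀ s ∈ S, ∀ t ∈ S, s + t ∈ S)
    (hsmul : ∀ c : X → ℂ, Measurable c → ∀ s ∈ S, (fun u => c u • s u) ∈ S) :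
    ∃ e : ℕ → ∀ u, E.fiber u, (∀ i, e i ∈ S) ∧
      ∀ u, IsTotalOrthonormalOrZero fun i => e i u := by
  obtain ⟨C, hC, hCc, hCd⟩ := IsBorel.exists_total (E := E)
  -- the zero section is added so that the range of a sequence can be the whole family
  obtain ⟨a, ha⟩ := (hCc.insert 0).exists_eq_range (Set.insert_nonempty 0 C)
  have haS : ∀ i, a i ∈ S := by
    intro i
    have h : a i ∈ insert 0 C := ha ▸ Set.mem_range_self i
    rcases h with h | h
    · rw [h]
      exact hzero
    · exact hgen (hC h)
  have had : ∀ u, Dense (Submodule.span ℂ (Set.range fun i => a i u) : Set (E.fiber u)) := by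
    intro u
    refine (hCd u).mono (Submodule.span_mono ?_)
    rintro _ ⟨s, hs, rfl⟩
    obtain ⟨i, rfl⟩ : s ∈ Set.range a := ha ▸ Set.mem_insert_of_mem 0 hs
    exact ⟨i, rfl⟩
  have hsum : ∀ (T : Finset ℕ) (f : ℕ → ∀ u, E.fiber u), (∀ i ∈ T, f i ∈ S) →
      ∑ i ∈ T, f i ∈ S := by
    intro T f hf
    induction T using Finset.cons_induction with
    | empty => simpa using hzero
    | cons i T hi ih =>
      rw [Finset.sum_cons]
      exact hadd _ (hf i (Finset.mem_cons_self i T)) _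
        (ih fun j hj => hf j (Finset.mem_cons_of_mem hj))
  have hgs : ∀ n, (fun u => InnerProductSpace.gramSchmidt ℂ (fun i => a i u) n) ∈ S := by
    intro n
    induction n using Nat.strong_induction_on with
    | _ n ih =>
      have heq : (fun u => InnerProductSpace.gramSchmidt ℂ (fun i => a i u) n) =
          a n + ∑ i ∈ Finset.Iio n, fun u =>
            (-(inner ℂ (InnerProductSpace.gramSchmidt ℂ (fun i => a i u) i) (a n u) /
              inner ℂ (InnerProductSpace.gramSchmidt ℂ (fun i => a i u) i)
                (InnerProductSpace.gramSchmidt ℂ (fun i => a i u) i)) : ℂ) •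
              InnerProductSpace.gramSchmidt ℂ (fun i => a i u) i := by
        funext u
        have h := InnerProductSpace.gramSchmidt_def'' ℂ (fun i => a i u) n
        simp only [Pi.add_apply, Finset.sum_apply, neg_smul, Finset.sum_neg_distrib,
          inner_self_eq_norm_sq_to_K]
        rw [← sub_eq_add_neg]
        exact eq_sub_of_add_eq h.symm
      rw [heq]
      refine hadd _ (haS n) _ (hsum _ _ fun i hi => hsmul _ ?_ _ (ih i (Finset.mem_Iio.1 hi)))
      have hi' := hS _ (ih i (Finset.mem_Iio.1 hi))
      exact ((hi'.measurable_inner (hS _ (haS n))).div (hi'.measurable_inner hi')).neg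
  refine ⟨fun n u => InnerProductSpace.gramSchmidtNormed ℂ (fun i => a i u) n, fun n => ?_,
    fun u => isTotalOrthonormalOrZero_gramSchmidtNormed (had u)⟩
  refine hsmul _ ?_ _ (hgs n)
  have h := E.measurable_norm measurable_id (hS _ (hgs n))
  exact (Complex.measurable_ofReal.comp h).inv

/-- Elementary tensors as a bilinear map. -/
def tmulₗ (E : HilbertBundle.{u, w} X) (F : HilbertBundle.{u, w'} X) (u : X) :
    E.fiber u →ₗ[ℂ] F.fiber u →ₗ[ℂ] (E.tensor F).fiber u :=
  (TensorProduct.mk ℂ (E.fiber u) (F.fiber u)).compr₂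
    (UniformSpace.Completion.toComplₗᵢ (𝕜 := ℂ) (E := E.fiber u ⊗[ℂ] F.fiber u)).toLinearMap

theorem inner_tmulₗ (E : HilbertBundle.{u, w} X) (F : HilbertBundle.{u, w'} X) (u : X)
    (x : E.fiber u) (y : F.fiber u) (x' : E.fiber u) (y' : F.fiber u) :
    inner ℂ (E.tmulₗ F u x y) (E.tmulₗ F u x' y') = inner ℂ x x' * inner ℂ y y' :=
  E.inner_tmul_tmul F x x' y y'

/-- The partial inner product `⟨x, ·⟩` on the fibre of a tensor product of Hilbert bundles. -/
def contract (E : HilbertBundle.{u, w} X) (F : HilbertBundle.{u, w'} X) {u : X} (x : E.fiber u) :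
    (E.tensor F).fiber u →L[ℂ] F.fiber u :=
  partialInner (E.tmulₗ F u) (E.inner_tmulₗ F u) x

theorem inner_contract (E : HilbertBundle.{u, w} X) (F : HilbertBundle.{u, w'} X) {u : X}
    (x : E.fiber u) (y : F.fiber u) (z : (E.tensor F).fiber u) :
    inner ℂ y (E.contract F x z) = inner ℂ (E.tmul F x y) z :=
  inner_partialInner _ _ _ _ _

theorem norm_contract_le (E : HilbertBundle.{u, w} X) (F : HilbertBundle.{u, w'} X) {u : X}
    (x : E.fiber u) (z : (E.tensor F).fiber u) : ‖E.contract F x z‖ ≤ ‖x‖ * ‖z‖ :=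
  norm_partialInner_le _ _ _ _

theorem tendsto_sum_tmul_contract (E : HilbertBundle.{u, w} X) (F : HilbertBundle.{u, w'} X)
    {u : X} {e : ℕ → E.fiber u} (he : IsTotalOrthonormalOrZero e) (z : (E.tensor F).fiber u) :
    Filter.Tendsto (fun n => ∑ i ∈ Finset.range n, E.tmul F (e i) (E.contract F (e i) z))
      Filter.atTop (𝓝 z) := by
  refine tendsto_partialExpansion (E.tmulₗ F u) (E.inner_tmulₗ F u) he ?_ z
  exact dense_span_tmul he.dense_span (by
    rw [Submodule.span_univ]
    exact dense_univ)

theorem norm_sub_sum_tmul_contract_le (E : HilbertBundle.{u, w} X) (F : HilbertBundle.{u, w'} X)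
    {u : X} {e : ℕ → E.fiber u} (he : IsTotalOrthonormalOrZero e) (n : ℕ)
    (z : (E.tensor F).fiber u) :
    ‖z - ∑ i ∈ Finset.range n, E.tmul F (e i) (E.contract F (e i) z)‖ ≤ ‖z‖ :=
  norm_sub_partialExpansion_le (E.tmulₗ F u) (E.inner_tmulₗ F u) he n z

theorem measurable_inner_tmul {Ω : Type*} [MeasurableSpace Ω] (E : HilbertBundle.{u, w} X)
    (F : HilbertBundle.{u, w'} X) {p : Ω → X} {ξ : ∀ ω, E.fiber (p ω)} {η : ∀ ω, F.fiber (p ω)}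
    (hξ : ∀ e ∈ E.gen, Measurable fun ω => inner ℂ (e (p ω)) (ξ ω))
    (hη : ∀ f ∈ F.gen, Measurable fun ω => inner ℂ (f (p ω)) (η ω)) :
    ∀ σ ∈ (E.tensor F).gen,
      Measurable fun ω => inner ℂ (σ (p ω)) (E.tmul F (ξ ω) (η ω)) := by
  rintro σ ⟨e, he, f, hf, hσ⟩
  have heq : (fun ω => inner ℂ (σ (p ω)) (E.tmul F (ξ ω) (η ω))) =
      fun ω => inner ℂ (e (p ω)) (ξ ω) * inner ℂ (f (p ω)) (η ω) := by
    funext ω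
    rw [hσ]
    exact E.inner_tmul_tmul F _ _ _ _
  rw [heq]
  exact (hξ e he).mul (hη f hf)

theorem measurable_inner_contract {Ω : Type*} [MeasurableSpace Ω] (E : HilbertBundle.{u, w} X)
    (F : HilbertBundle.{u, w'} X) [E.IsBorel] [F.IsBorel] {p : Ω → X} (hp : Measurable p)
    {ξ : ∀ ω, E.fiber (p ω)} {ζ : ∀ ω, (E.tensor F).fiber (p ω)}
    (hξ : ∀ e ∈ E.gen, Measurable fun ω => inner ℂ (e (p ω)) (ξ ω))
    (hζ : ∀ σ ∈ (E.tensor F).gen, Measurable fun ω => inner ℂ (σ (p ω)) (ζ ω)) :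
    ∀ f ∈ F.gen, Measurable fun ω => inner ℂ (f (p ω)) (E.contract F (ξ ω) (ζ ω)) := by
  intro f hf
  simp_rw [inner_contract]
  exact (E.tensor F).measurable_inner_of hp (E.measurable_inner_tmul F hξ fun f' hf' =>
    (IsBorel.measurable_inner f' hf' f hf).comp hp) hζ

end HilbertBundle

/-! ### Sections of the bundle of `L|_H ⊗ M` over a fibre of `G` -/

namespace Rep

variable {X : Type u} [Groupoid.{v} X] [TopologicalSpace X] [TopologicalSpace (Arr X)]
  [MeasurableSpace X]

theorem measurable_inner_op_inv [IsLCGroupoid X] [BorelSpace X] {lam : HaarSystem X}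
    {μ : Measure X} (L : Rep.{u, v, w} lam μ) [L.IsBorel] {s : ∀ u, L.bundle.fiber u}
    (hs : L.bundle.IsBorelSection s) :
    ∀ e ∈ L.bundle.gen, Measurable fun g : Arr X =>
      inner ℂ (e g.src) (L.op (Groupoid.inv g.hom) (s g.tgt)) := by
  intro e he
  have ht : Measurable (Arr.tgt : Arr X → X) := IsLCGroupoid.continuous_tgt.measurable
  have h := L.bundle.measurable_inner_of ht (ξ := fun g : Arr X => L.op g.hom (e g.src))
    (η := fun g : Arr X => s g.tgt) (fun f hf => IsBorel.measurable_op e he f hf)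
    (fun f hf => (hs f hf).comp ht)
  have heq : (fun g : Arr X => inner ℂ (e g.src) (L.op (Groupoid.inv g.hom) (s g.tgt))) =
      fun g : Arr X => inner ℂ (L.op g.hom (e g.src)) (s g.tgt) := by
    funext g
    rw [← (L.op g.hom).inner_map_map (e g.src), L.op_op_inv]
  rw [heq]
  exact h

/-- The section supported at `u` is Borel, as the points of the unit space are closed. -/
theorem exists_isBorelSection_apply_eq [IsLCGroupoid X] [BorelSpace X]
    (E : HilbertBundle.{u, w} X) {u : X} (ξ : E.fiber u) :
    ∃ s : ∀ u, E.fiber u, E.IsBorelSection s ∧ s u = ξ := by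
  classical
  have := t2Space_units (X := X)
  refine ⟨Pi.single u ξ, fun e he => ?_, Pi.single_eq_same u ξ⟩
  have heq : (fun a => inner ℂ (e a) ((Pi.single u ξ : ∀ a, E.fiber a) a)) =
      Set.indicator {u} fun _ => (inner ℂ (e u) ξ : ℂ) := by
    funext a
    by_cases h : a = u
    · subst h
      simp
    · simp [h]
  rw [heq]
  exact measurable_const.indicator (measurableSet_singleton u)

variable {lam : HaarSystem X} {H : ClosedSubgroupoid X} {μ : Measure X}
  {beta : HaarSystem H.Units} (L : Rep.{u, v, w} lam μ) (M : Rep.{u, v, w'} beta (H.onUnits μ))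

/-- The section `x ↦ L_{x⁻¹} ξ ⊗ η(x)` over `G^u`. -/
def tensorFun {u : X} (ξ : L.bundle.fiber u) (η : ∀ x : Fib u, M.bundle.fiber (H.unit x.src))
    (x : Fib u) : ((L.restrict H beta M.quasiInvariant).tensor M).bundle.fiber (H.unit x.src) :=
  (L.bundle.onUnits H).tmul M.bundle (u := H.unit x.src) (L.op (Groupoid.inv x.hom) ξ) (η x)

/-- The section `x ↦ ⟨L_{x⁻¹} ξ, ζ(x)⟩` over `G^u`, where the partial inner product is taken in the
first factor. -/
def contractFun {u : X} (ξ : L.bundle.fiber u)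
    (ζ : ∀ x : Fib u, ((L.restrict H beta M.quasiInvariant).tensor M).bundle.fiber (H.unit x.src))
    (x : Fib u) : M.bundle.fiber (H.unit x.src) :=
  (L.bundle.onUnits H).contract M.bundle (u := H.unit x.src) (L.op (Groupoid.inv x.hom) ξ) (ζ x)

theorem restrict_tensor_op_tmul {a b : H.Units} (h : a ⟶ b) (x : (L.bundle.onUnits H).fiber a)
    (y : M.bundle.fiber a) :
    ((L.restrict H beta M.quasiInvariant).tensor M).op h
        ((L.bundle.onUnits H).tmul M.bundle x y) =
      (L.bundle.onUnits H).tmul M.bundle (L.op (H.coeHom h) x) (M.op h y) :=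
  ContinuousLinearMap.completion_apply_coe _ _

variable {M} in
theorem IsEquivariant.tensorFun {u : X} (ξ : L.bundle.fiber u)
    {η : ∀ x : Fib u, M.bundle.fiber (H.unit x.src)} (hη : M.IsEquivariant η) :
    ((L.restrict H beta M.quasiInvariant).tensor M).IsEquivariant (L.tensorFun M ξ η) := by
  intro x a h hh
  have h1 : L.op (Groupoid.inv (h ≫ x.hom)) ξ =
      L.op (Groupoid.inv h) (L.op (Groupoid.inv x.hom) ξ) := by
    rw [← L.op_comp]
    congr 2
    simp
  refine Eq.trans ?_ (L.restrict_tensor_op_tmul M _ _ _).symm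
  exact congrArg₂ (fun p q => (L.bundle.onUnits H).tmul M.bundle (u := H.unit a) p q) h1
    (hη x h hh)

theorem op_contract {a b : H.Units} (h : a ⟶ b) (x : (L.bundle.onUnits H).fiber a)
    (z : ((L.bundle.onUnits H).tensor M.bundle).fiber a) :
    (L.bundle.onUnits H).contract M.bundle (u := b) (L.op (H.coeHom h) x)
        (((L.restrict H beta M.quasiInvariant).tensor M).op h z) =
      M.op h ((L.bundle.onUnits H).contract M.bundle x z) := by
  refine ext_inner_left ℂ fun k => ?_
  obtain ⟨y, rfl⟩ := (M.op h).surjective k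
  refine (HilbertBundle.inner_contract _ _ _ _ _).trans (Eq.trans ?_
    (((M.op h).inner_map_map _ _).trans (HilbertBundle.inner_contract _ _ _ _ _)).symm)
  exact (congrArg (fun r => inner ℂ r (((L.restrict H beta M.quasiInvariant).tensor M).op h z))
    (L.restrict_tensor_op_tmul M h x y).symm).trans (LinearIsometryEquiv.inner_map_map _ _ _)

variable {M} in
theorem IsEquivariant.contractFun {u : X} (ξ : L.bundle.fiber u)
    {ζ : ∀ x : Fib u, ((L.restrict H beta M.quasiInvariant).tensor M).bundle.fiber (H.unit x.src)}
    (hζ : ((L.restrict H beta M.quasiInvariant).tensor M).IsEquivariant ζ) :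
    M.IsEquivariant (L.contractFun M ξ ζ) := by
  intro x a h hh
  have h1 : L.op (Groupoid.inv (h ≫ x.hom)) ξ =
      L.op (Groupoid.inv h) (L.op (Groupoid.inv x.hom) ξ) := by
    rw [← L.op_comp]
    congr 2
    simp
  refine Eq.trans ?_ (L.op_contract M (Groupoid.inv (H.mkHom h hh)) _ _)
  exact congrArg₂ (fun p q => (L.bundle.onUnits H).contract M.bundle (u := H.unit a) p q) h1
    (hζ x h hh)

theorem enorm_tensorFun {u : X} (ξ : L.bundle.fiber u)
    (η : ∀ x : Fib u, M.bundle.fiber (H.unit x.src)) (x : Fib u) :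
    ‖L.tensorFun M ξ η x‖ₑ = ‖ξ‖ₑ * ‖η x‖ₑ := by
  have h : ‖L.tensorFun M ξ η x‖ = ‖ξ‖ * ‖η x‖ := by
    refine (UniformSpace.Completion.norm_coe _).trans ((TensorProduct.norm_tmul _ _).trans ?_)
    exact congrArg (· * ‖η x‖) ((L.op (Groupoid.inv x.hom)).norm_map ξ)
  rw [← ofReal_norm, ← ofReal_norm, ← ofReal_norm, h, ENNReal.ofReal_mul (norm_nonneg _)]

theorem enorm_contractFun_le {u : X} (ξ : L.bundle.fiber u)
    (ζ : ∀ x : Fib u, ((L.restrict H beta M.quasiInvariant).tensor M).bundle.fiber (H.unit x.src))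
    (x : Fib u) : ‖L.contractFun M ξ ζ x‖ₑ ≤ ‖ξ‖ₑ * ‖ζ x‖ₑ := by
  have h : ‖L.contractFun M ξ ζ x‖ ≤ ‖ξ‖ * ‖ζ x‖ := by
    refine (HilbertBundle.norm_contract_le _ _ _ _).trans_eq ?_
    exact congrArg (· * ‖ζ x‖) ((L.op (Groupoid.inv x.hom)).norm_map ξ)
  rw [← ofReal_norm, ← ofReal_norm, ← ofReal_norm, ← ENNReal.ofReal_mul (norm_nonneg _)]
  exact ENNReal.ofReal_le_ofReal h

section Borel

variable [IsLCGroupoid X] [BorelSpace X] [L.IsBorel]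

variable {M} in
theorem IsBorelOnFib.tensorFun {u : X} (ξ : L.bundle.fiber u)
    {η : ∀ x : Fib u, M.bundle.fiber (H.unit x.src)} (hη : M.IsBorelOnFib η) :
    ((L.restrict H beta M.quasiInvariant).tensor M).IsBorelOnFib (L.tensorFun M ξ η) := by
  obtain ⟨s, hs, rfl⟩ := exists_isBorelSection_apply_eq L.bundle ξ
  exact HilbertBundle.measurable_inner_tmul (L.bundle.onUnits H) M.bundle
    (p := fun x : Fib u => H.unit x.src) (ξ := fun x : Fib u => L.op (Groupoid.inv x.hom) (s u))
    (fun e he => (L.measurable_inner_op_inv hs e he).comp (Fib.continuous_toArr u).measurable) hη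

/-- If `s` is a Borel section of the bundle of `L`, and `ζ` is Borel over `G`, then so
is `g ↦ L_{g⁻¹} s(r(g)) ⊗ ζ(g)`. -/
theorem measurable_inner_tensor {s : ∀ u, L.bundle.fiber u} (hs : L.bundle.IsBorelSection s)
    {ζ : ∀ g : Arr X, M.bundle.fiber (H.unit g.src)}
    (hζ : ∀ e ∈ M.bundle.gen, Measurable fun g : Arr X => inner ℂ (e (H.unit g.src)) (ζ g)) :
    ∀ e ∈ ((L.restrict H beta M.quasiInvariant).tensor M).bundle.gen,
      Measurable fun g : Arr X => inner ℂ (e (H.unit g.src))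
        (L.tensorFun M (s g.tgt) (fun x => ζ x.toArr) ⟨g.src, g.hom⟩) :=
  HilbertBundle.measurable_inner_tmul (L.bundle.onUnits H) M.bundle
    (p := fun g : Arr X => H.unit g.src) (L.measurable_inner_op_inv hs) hζ

variable [M.IsBorel]

/-- If `s` is a Borel section of the bundle of `L`, and `ζ` is Borel over `G`, then so
is `g ↦ ⟨L_{g⁻¹} s(r(g)), ζ(g)⟩`. -/
theorem measurable_inner_contract {s : ∀ u, L.bundle.fiber u} (hs : L.bundle.IsBorelSection s)
    {ζ : ∀ g : Arr X,
      ((L.restrict H beta M.quasiInvariant).tensor M).bundle.fiber (H.unit g.src)}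
    (hζ : ∀ e ∈ ((L.restrict H beta M.quasiInvariant).tensor M).bundle.gen,
      Measurable fun g : Arr X => inner ℂ (e (H.unit g.src)) (ζ g)) :
    ∀ e ∈ M.bundle.gen, Measurable fun g : Arr X => inner ℂ (e (H.unit g.src))
      (L.contractFun M (s g.tgt) (fun x => ζ x.toArr) ⟨g.src, g.hom⟩) := by
  have hs' : Measurable (Arr.src : Arr X → X) := IsLCGroupoid.continuous_src.measurable
  have hp : Measurable fun g : Arr X => H.unit g.src := hs'
  exact HilbertBundle.measurable_inner_contract (L.bundle.onUnits H) M.bundle hp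
    (L.measurable_inner_op_inv hs) hζ

variable {M} in
theorem IsBorelOnFib.contractFun {u : X} (ξ : L.bundle.fiber u)
    {ζ : ∀ x : Fib u, ((L.restrict H beta M.quasiInvariant).tensor M).bundle.fiber (H.unit x.src)}
    (hζ : ((L.restrict H beta M.quasiInvariant).tensor M).IsBorelOnFib ζ) :
    M.IsBorelOnFib (L.contractFun M ξ ζ) := by
  obtain ⟨s, hs, rfl⟩ := exists_isBorelSection_apply_eq L.bundle ξ
  have hp : Measurable fun x : Fib u => H.unit x.src := (Fib.continuous_src u).measurable
  exact HilbertBundle.measurable_inner_contract (L.bundle.onUnits H) M.bundle hp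
    (ξ := fun x : Fib u => L.op (Groupoid.inv x.hom) (s u))
    (fun e he => (L.measurable_inner_op_inv hs e he).comp (Fib.continuous_toArr u).measurable) hζ

variable (D : InductionMeasure lam H μ)

theorem tensorFun_mem {u : X} (ξ : L.bundle.fiber u) (η : M.SqSec D u) :
    L.tensorFun M ξ η.val ∈ ((L.restrict H beta M.quasiInvariant).tensor M).sqSections D u := by
  refine ⟨η.mem.1.tensorFun L ξ, η.mem.2.1.tensorFun L ξ, ?_⟩
  simp only [enorm_tensorFun, mul_pow]
  rw [lintegral_const_mul' _ _ (by simp)]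
  exact ENNReal.mul_lt_top (by simp) η.mem.2.2

theorem contractFun_mem {u : X} (ξ : L.bundle.fiber u)
    (ζ : ((L.restrict H beta M.quasiInvariant).tensor M).SqSec D u) :
    L.contractFun M ξ ζ.val ∈ M.sqSections D u := by
  refine ⟨ζ.mem.1.contractFun L ξ, ζ.mem.2.1.contractFun L ξ, ?_⟩
  refine (lintegral_mono fun q =>
    pow_le_pow_left' (L.enorm_contractFun_le M ξ ζ.val _) 2).trans_lt ?_
  simp only [mul_pow]
  rw [lintegral_const_mul' _ _ (by simp)]
  exact ENNReal.mul_lt_top (by simp) ζ.mem.2.2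

/-- The bilinear map `(ξ, η) ↦ (x ↦ L_{x⁻¹} ξ ⊗ η(x))` into square integrable sections. -/
def tensorSq (u : X) : L.bundle.fiber u →ₗ[ℂ] M.SqSec D u →ₗ[ℂ]
    ((L.restrict H beta M.quasiInvariant).tensor M).SqSec D u :=
  LinearMap.mk₂ ℂ
    (fun ξ η => ((L.restrict H beta M.quasiInvariant).tensor M).mkSq D _ (L.tensorFun_mem M D ξ η))
    (fun ξ ξ' η => SqSec.ext (funext fun x =>
      (congrArg (fun r => (L.bundle.onUnits H).tmulₗ M.bundle (H.unit x.src) r (η.val x))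
        (map_add (L.op (Groupoid.inv x.hom)) ξ ξ')).trans (LinearMap.map_add₂ _ _ _ _)))
    (fun c ξ η => SqSec.ext (funext fun x =>
      (congrArg (fun r => (L.bundle.onUnits H).tmulₗ M.bundle (H.unit x.src) r (η.val x))
        (map_smul (L.op (Groupoid.inv x.hom)) c ξ)).trans (LinearMap.map_smul₂ _ _ _ _)))
    (fun _ _ _ => SqSec.ext (funext fun x =>
      map_add ((L.bundle.onUnits H).tmulₗ M.bundle (H.unit x.src) _) _ _))
    (fun c _ _ => SqSec.ext (funext fun x =>
      map_smul ((L.bundle.onUnits H).tmulₗ M.bundle (H.unit x.src) _) c _))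

/-- The square integrable section `x ↦ ⟨L_{x⁻¹} ξ, ζ(x)⟩`. -/
def contractSq {u : X} (ξ : L.bundle.fiber u)
    (ζ : ((L.restrict H beta M.quasiInvariant).tensor M).SqSec D u) : M.SqSec D u :=
  M.mkSq D _ (L.contractFun_mem M D ξ ζ)

theorem inner_tensorSq {u : X} (ξ : L.bundle.fiber u) (η : M.SqSec D u) (ξ' : L.bundle.fiber u)
    (η' : M.SqSec D u) : inner ℂ (L.tensorSq M D u ξ η) (L.tensorSq M D u ξ' η') =
      inner ℂ ξ ξ' * inner ℂ η η' := by
  change (∫ q, inner ℂ (L.tensorFun M ξ η.val (H.rep q)) (L.tensorFun M ξ' η'.val (H.rep q))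
      ∂(D.fib u)) =
    inner ℂ ξ ξ' * ∫ q, inner ℂ (η.val (H.rep q)) (η'.val (H.rep q)) ∂(D.fib u)
  rw [← integral_const_mul]
  refine integral_congr_ae (Filter.Eventually.of_forall fun q => ?_)
  refine (HilbertBundle.inner_tmul_tmul _ _ _ _ _ _).trans ?_
  exact congrArg (· * inner ℂ (η.val (H.rep q)) (η'.val (H.rep q)))
    ((L.op (Groupoid.inv (H.rep q).hom)).inner_map_map ξ ξ')

/-- A square integrable section `ζ` is the sum of the sections `x ↦ L_{x⁻¹} eᵢ ⊗ ⟨L_{x⁻¹} eᵢ, ζ(x)⟩`.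
The convergence is pointwise by unitarity of `L_{x⁻¹}`, and dominated by `ζ`. -/
theorem tendsto_sum_tensorSq_contractSq {u : X} {e : ℕ → L.bundle.fiber u}
    (he : IsTotalOrthonormalOrZero e)
    (ζ : ((L.restrict H beta M.quasiInvariant).tensor M).SqSec D u) :
    Filter.Tendsto (fun n => ∑ i ∈ Finset.range n,
      L.tensorSq M D u (e i) (L.contractSq M D (e i) ζ)) Filter.atTop (𝓝 ζ) := by
  set S : ℕ → ((L.restrict H beta M.quasiInvariant).tensor M).SqSec D u := fun n =>
    ∑ i ∈ Finset.range n, L.tensorSq M D u (e i) (L.contractSq M D (e i) ζ) with hS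
  have hval : ∀ n (x : Fib u), (S n).val x = ∑ i ∈ Finset.range n,
      (L.bundle.onUnits H).tmul M.bundle (u := H.unit x.src) (L.op (Groupoid.inv x.hom) (e i))
        ((L.bundle.onUnits H).contract M.bundle (u := H.unit x.src)
          (L.op (Groupoid.inv x.hom) (e i)) (ζ.val x)) := by
    intro n x
    induction n with
    | zero => rfl
    | succ n ih =>
      rw [Finset.sum_range_succ, ← ih]
      simp only [hS, Finset.sum_range_succ, val_add, Pi.add_apply]
      rfl
  have hx : ∀ x : Fib u, IsTotalOrthonormalOrZero
      (E := (L.bundle.onUnits H).fiber (H.unit x.src)) fun i => L.op (Groupoid.inv x.hom) (e i) :=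
    fun x => he.map (L.op (Groupoid.inv x.hom))
  have hlim : Filter.Tendsto (fun n => ∫ q, ‖(ζ - S n).val (H.rep q)‖ ^ 2 ∂(D.fib u))
      Filter.atTop (𝓝 (∫ _, 0 ∂(D.fib u))) := by
    refine tendsto_integral_of_dominated_convergence (fun q => ‖ζ.val (H.rep q)‖ ^ 2)
      (fun n => (integrable_norm_sq _ D (ζ - S n)).aestronglyMeasurable)
      (integrable_norm_sq _ D ζ) (fun n => Filter.Eventually.of_forall fun q => ?_)
      (Filter.Eventually.of_forall fun q => ?_)
    · have h := HilbertBundle.norm_sub_sum_tmul_contract_le _ M.bundle (hx (H.rep q)) n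
        (ζ.val (H.rep q))
      rw [Real.norm_of_nonneg (sq_nonneg _), val_sub, Pi.sub_apply, hval]
      exact pow_le_pow_left₀ (norm_nonneg _) h 2
    · have h := HilbertBundle.tendsto_sum_tmul_contract _ M.bundle (hx (H.rep q))
        (ζ.val (H.rep q))
      have h2 := (((tendsto_const_nhds (x := ζ.val (H.rep q))).sub h).norm).pow 2
      rw [sub_self, norm_zero, zero_pow two_ne_zero] at h2
      refine h2.congr fun n => ?_
      rw [val_sub, Pi.sub_apply, hval]
      rfl
  rw [integral_zero] at hlim
  simp only [← norm_sq_eq] at hlim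
  have h := hlim.sqrt
  simp only [Real.sqrt_sq (norm_nonneg _), Real.sqrt_zero] at h
  rw [tendsto_iff_norm_sub_tendsto_zero]
  exact h.congr fun n => norm_sub_rev _ _

end Borel

end Rep

/-! ### The unitaries between the fibres of `L ⊗ Ind M` and `Ind (L|_H ⊗ M)` -/

namespace Rep

variable {X : Type u} [Groupoid.{v} X] [TopologicalSpace X] [TopologicalSpace (Arr X)]
  [MeasurableSpace X] [IsLCGroupoid X] [BorelSpace X]
  {lam : HaarSystem X} {H : ClosedSubgroupoid X} {μ : Measure X}
  {beta : HaarSystem H.Units} (L : Rep.{u, v, w} lam μ)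
  (M : Rep.{u, v, w'} beta (H.onUnits μ)) [M.IsBorel] (D : InductionMeasure lam H μ)

/-- Isometries on a fibre of `L ⊗ Ind M` are determined by their values on the tensors `ξ ⊗ η`
with `η` a square integrable section. -/
theorem linearIsometryEquiv_ext_tmul_indVec {u : X} {Q : Type*} [NormedAddCommGroup Q]
    [InnerProductSpace ℂ Q] (S T : (L.bundle.tensor (M.ind D).bundle).fiber u ≃ₗᵢ[ℂ] Q)
    (h : ∀ ξ η, S (L.bundle.tmul (M.ind D).bundle ξ (M.indVec D η)) =
      T (L.bundle.tmul (M.ind D).bundle ξ (M.indVec D η))) (z) : S z = T z := by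
  have hd : Dense (Submodule.span ℂ (Set.range (M.indVec D (u := u))) :
      Set ((M.ind D).bundle.fiber u)) :=
    (UniformSpace.Completion.denseRange_coe (α := M.SqSec D u)).mono Submodule.subset_span
  have hd' := dense_span_tmul (s := (Set.univ : Set (L.bundle.fiber u))) (by
    rw [Submodule.span_univ]
    exact dense_univ) hd
  have hST := ContinuousLinearMap.ext_on (f := S.toContinuousLinearEquiv.toContinuousLinearMap)
    (g := T.toContinuousLinearEquiv.toContinuousLinearMap) hd' (by
    rintro _ ⟨ξ, -, _, ⟨η, rfl⟩, rfl⟩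
    exact h ξ η)
  exact DFunLike.congr_fun hST z

theorem ind_op_indVec {u v : X} (g : u ⟶ v) (η : M.SqSec D u) :
    (M.ind D).op g (M.indVec D η) = M.indVec D (M.indPre D g η) :=
  ContinuousLinearMap.completion_apply_coe _ _

theorem changeMeasure_tensor_op_tmul (g₁ : QuasiInvariant lam D.base) (h₁ : μ ≪ D.base)
    (h₂ : D.base ≪ μ) {u v : X} (g : u ⟶ v) (ξ : L.bundle.fiber u)
    (y : (M.ind D).bundle.fiber u) :
    ((L.changeMeasure g₁ h₁ h₂).tensor (M.ind D)).op g (L.bundle.tmul (M.ind D).bundle ξ y) =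
      L.bundle.tmul (M.ind D).bundle (L.op g ξ) ((M.ind D).op g y) :=
  ContinuousLinearMap.completion_apply_coe _ _

variable [L.IsBorel]

theorem dense_span_tensorSq (u : X) : Dense (Submodule.span ℂ (Set.range
    fun r : L.bundle.fiber u × M.SqSec D u => (L.tensorSq M D u r.1 r.2 :
      UniformSpace.Completion (((L.restrict H beta M.quasiInvariant).tensor M).SqSec D u))) :
    Set (UniformSpace.Completion
      (((L.restrict H beta M.quasiInvariant).tensor M).SqSec D u))) := by
  obtain ⟨e, -, he⟩ := L.bundle.exists_isTotalOrthonormalOrZero {s | L.bundle.IsBorelSection s}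
    (fun _ hs => hs) (fun _ he => .of_mem_gen he) .zero (fun _ hs _ ht => hs.add ht)
    (fun _ hc _ hs => hs.smul hc)
  intro z
  induction z using UniformSpace.Completion.induction_on with
  | hp => exact isClosed_closure
  | ih ζ =>
    have h := ((UniformSpace.Completion.continuous_coe _).tendsto ζ).comp
      (L.tendsto_sum_tensorSq_contractSq M D (he u) ζ)
    refine mem_closure_of_tendsto h (Filter.Eventually.of_forall fun n => ?_)
    have hsum := map_sum (UniformSpace.Completion.toComplₗᵢ (𝕜 := ℂ)
      (E := ((L.restrict H beta M.quasiInvariant).tensor M).SqSec D u)).toLinearMap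
      (fun i => L.tensorSq M D u (e i u) (L.contractSq M D (e i u) ζ)) (Finset.range n)
    change UniformSpace.Completion.toComplₗᵢ (𝕜 := ℂ) _ ∈ _
    refine (congrArg (· ∈ _) hsum).mpr (Submodule.sum_mem _ fun i _ => Submodule.subset_span ?_)
    exact ⟨(e i u, L.contractSq M D (e i u) ζ), rfl⟩

/-- The unitary `U(u)`. -/
theorem exists_unitary (u : X) : ∃ U : (L.bundle.tensor (M.ind D).bundle).fiber u ≃ₗᵢ[ℂ]
      (((L.restrict H beta M.quasiInvariant).tensor M).ind D).bundle.fiber u,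
    ∀ ξ η, U (L.bundle.tmul (M.ind D).bundle ξ (M.indVec D η)) =
      ((L.restrict H beta M.quasiInvariant).tensor M).indVec D (L.tensorSq M D u ξ η) :=
  exists_isometryEquiv_completion_tensor (L.tensorSq M D u) (L.inner_tensorSq M D)
    (L.dense_span_tensorSq M D u)

theorem indPre_tensorSq {u v : X} (g : u ⟶ v) (ξ : L.bundle.fiber u) (η : M.SqSec D u) :
    ((L.restrict H beta M.quasiInvariant).tensor M).indPre D g (L.tensorSq M D u ξ η) =
      L.tensorSq M D v (L.op g ξ) (M.indPre D g η) := by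
  refine SqSec.ext (funext fun x => ?_)
  have h : L.op (Groupoid.inv (x.hom ≫ Groupoid.inv g)) ξ =
      L.op (Groupoid.inv x.hom) (L.op g ξ) := by
    rw [← L.op_comp]
    congr 2
    simp
  set c : ℂ := ((√(D.deriv g (H.fibMk x)).toReal : ℝ) : ℂ)
  set y : Fib u := ⟨x.src, x.hom ≫ Groupoid.inv g⟩
  refine (congrArg (fun r => c • (L.bundle.onUnits H).tmulₗ M.bundle (H.unit x.src) r (η.val y))
    h).trans ?_
  exact (map_smul ((L.bundle.onUnits H).tmulₗ M.bundle (H.unit x.src) _) c (η.val y)).symm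

/-! ### Borel sections -/

/-- If `s` is a Borel section of the bundle of `L` and `z` is one of the sections that determine
the Borel structure of the bundle of `Ind M`, then the sections `x ↦ L_{x⁻¹} s(u) ⊗ z(u)(x)` give one
that determines the Borel structure of the bundle of `Ind (L|_H ⊗ M)`. -/
theorem exists_tensorSq_mem_gen {s : ∀ u, L.bundle.fiber u} (hs : L.bundle.IsBorelSection s)
    {z : ∀ u, (M.ind D).bundle.fiber u} (hz : z ∈ (M.ind D).bundle.gen) :
    ∃ η : ∀ u, M.SqSec D u, (∀ u, z u = M.indVec D (η u)) ∧
      (fun u => ((L.restrict H beta M.quasiInvariant).tensor M).indVec D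
        (L.tensorSq M D u (s u) (η u))) ∈
        (((L.restrict H beta M.quasiInvariant).tensor M).ind D).bundle.gen := by
  obtain ⟨ζ, hζ, h, hzu⟩ := hz
  exact ⟨fun u => M.mkSq D _ (h u), hzu,
    fun g => L.tensorFun M (s g.tgt) (fun x => ζ x.toArr) ⟨g.src, g.hom⟩,
    L.measurable_inner_tensor M hs hζ, fun u => L.tensorFun_mem M D (s u) (M.mkSq D _ (h u)),
    fun u => rfl⟩

/-- The sections that determine the Borel structure of the bundle of `Ind (L|_H ⊗ M)` are carried to
ones that determine the Borel structure of the bundle of `Ind M` by partial inner products with Borel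
sections of the bundle of `L`. -/
theorem contractSq_mem_gen {ζ : ∀ g : Arr X,
      ((L.restrict H beta M.quasiInvariant).tensor M).bundle.fiber (H.unit g.src)}
    (hζ : ∀ e ∈ ((L.restrict H beta M.quasiInvariant).tensor M).bundle.gen,
      Measurable fun g : Arr X => inner ℂ (e (H.unit g.src)) (ζ g))
    (h : ∀ u : X, (fun x : Fib u => ζ x.toArr) ∈
      ((L.restrict H beta M.quasiInvariant).tensor M).sqSections D u)
    {s : ∀ u, L.bundle.fiber u} (hs : L.bundle.IsBorelSection s) :
    (fun u => M.indVec D (L.contractSq M D (s u)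
      (((L.restrict H beta M.quasiInvariant).tensor M).mkSq D _ (h u)))) ∈
        (M.ind D).bundle.gen :=
  ⟨fun g => L.contractFun M (s g.tgt) (fun x => ζ x.toArr) ⟨g.src, g.hom⟩,
    L.measurable_inner_contract M hs hζ,
    fun u => L.contractFun_mem M D (s u)
      (((L.restrict H beta M.quasiInvariant).tensor M).mkSq D _ (h u)),
    fun _ => rfl⟩

/-- Fibrewise unitaries that satisfy the formula for `U` carry Borel sections to Borel sections.
The section `z` that tests the image is expanded along a Borel orthonormal
sequence of sections of the bundle of `L`. -/
theorem isBorelSection_unitary_iff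
    (U : ∀ u : X, (L.bundle.tensor (M.ind D).bundle).fiber u ≃ₗᵢ[ℂ]
      (((L.restrict H beta M.quasiInvariant).tensor M).ind D).bundle.fiber u)
    (hU : ∀ u ξ η, U u (L.bundle.tmul (M.ind D).bundle ξ (M.indVec D η)) =
      ((L.restrict H beta M.quasiInvariant).tensor M).indVec D (L.tensorSq M D u ξ η))
    (σ : ∀ u, (L.bundle.tensor (M.ind D).bundle).fiber u) :
    (L.bundle.tensor (M.ind D).bundle).IsBorelSection σ ↔
      (((L.restrict H beta M.quasiInvariant).tensor M).ind D).bundle.IsBorelSection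
        fun u => U u (σ u) := by
  constructor
  · intro hσ z hz
    obtain ⟨ζ, hζ, h, hzu⟩ := hz
    -- the sections `s` for which all `s ⊗ y` are admissible as test sections for `σ`
    obtain ⟨e, heS, he⟩ := L.bundle.exists_isTotalOrthonormalOrZero
      {s | L.bundle.IsBorelSection s ∧ ∀ y ∈ (M.ind D).bundle.gen, Measurable fun u =>
        inner ℂ (L.bundle.tmulₗ (M.ind D).bundle u (s u) (y u)) (σ u)}
      (fun _ hs => hs.1)
      (fun e he => ⟨.of_mem_gen he, fun y hy => hσ _ ⟨e, he, y, hy, fun u => rfl⟩⟩)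
      ⟨.zero, fun y _ => by
          simp only [Pi.zero_apply, map_zero, LinearMap.zero_apply, inner_zero_left]
          exact measurable_const⟩
      (fun s hs t ht => ⟨hs.1.add ht.1, fun y hy => by
          simp only [Pi.add_apply, map_add, LinearMap.add_apply, inner_add_left]
          exact (hs.2 y hy).add (ht.2 y hy)⟩)
      (fun c hc s hs => ⟨hs.1.smul hc, fun y hy => by
          simp only [map_smul, LinearMap.smul_apply, inner_smul_left]
          exact (Complex.continuous_conj.measurable.comp hc).mul (hs.2 y hy)⟩)
    set Z : ∀ u, ((L.restrict H beta M.quasiInvariant).tensor M).SqSec D u := fun u =>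
      ((L.restrict H beta M.quasiInvariant).tensor M).mkSq D _ (h u) with hZ
    refine measurable_of_tendsto_metrizable (f := fun n u => ∑ i ∈ Finset.range n,
      inner ℂ (L.bundle.tmulₗ (M.ind D).bundle u (e i u)
        (M.indVec D (L.contractSq M D (e i u) (Z u)))) (σ u))
      (fun n => Finset.measurable_sum _ fun i _ =>
        (heS i).2 _ (L.contractSq_mem_gen M D hζ h (heS i).1)) (tendsto_pi_nhds.2 fun u => ?_)
    have hlim := ((UniformSpace.Completion.continuous_coe _).tendsto (Z u)).comp
      (L.tendsto_sum_tensorSq_contractSq M D (he u) (Z u))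
    have hz' : z u = ((L.restrict H beta M.quasiInvariant).tensor M).indVec D (Z u) := hzu u
    rw [hz']
    refine (Filter.Tendsto.inner (𝕜 := ℂ) hlim
      (tendsto_const_nhds (x := U u (σ u)))).congr fun n => ?_
    have hsum := map_sum (UniformSpace.Completion.toComplₗᵢ (𝕜 := ℂ)
      (E := ((L.restrict H beta M.quasiInvariant).tensor M).SqSec D u)).toLinearMap
      (fun i => L.tensorSq M D u (e i u) (L.contractSq M D (e i u) (Z u))) (Finset.range n)
    refine (congrArg (fun r : (((L.restrict H beta M.quasiInvariant).tensor M).ind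
      D).bundle.fiber u => inner ℂ r (U u (σ u))) hsum).trans ?_
    refine (sum_inner _ _ _).trans (Finset.sum_congr rfl fun i _ => ?_)
    rw [← (U u).inner_map_map]
    exact congrArg (fun r : (((L.restrict H beta M.quasiInvariant).tensor M).ind
      D).bundle.fiber u => inner ℂ r (U u (σ u))) (hU u _ _).symm
  · rintro hσ τ ⟨e, he, z, hz, hτ⟩
    obtain ⟨η, hη, hgen⟩ := L.exists_tensorSq_mem_gen M D
      (.of_mem_gen he) hz
    have heq : (fun u => inner ℂ (τ u) (σ u)) = fun u =>
        inner ℂ (((L.restrict H beta M.quasiInvariant).tensor M).indVec D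
          (L.tensorSq M D u (e u) (η u))) (U u (σ u)) := by
      funext u
      rw [← hU, LinearIsometryEquiv.inner_map_map, ← hη]
      exact congrArg (fun r => inner ℂ r (σ u)) (hτ u)
    rw [heq]
    exact hσ _ hgen

end Rep

end TopGpd

end

theorem propositionE2p5 {X : Type u} [Groupoid.{v} X] [TopologicalSpace X]
    [TopologicalSpace (TopGpd.Arr X)] [TopGpd.IsLCGroupoid X] [MeasurableSpace X] [BorelSpace X]
    (lam : TopGpd.HaarSystem X) (H : TopGpd.ClosedSubgroupoid X)
    (beta : TopGpd.HaarSystem H.Units) (μ : Measure X)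
    (L : TopGpd.Rep.{u, v, w} lam μ) [L.IsBorel]
    (M : TopGpd.Rep.{u, v, w'} beta (H.onUnits μ)) [M.IsBorel]
    (D : TopGpd.InductionMeasure lam H μ) :
    ∃ U : TopGpd.Rep.Equivalence
        ((L.changeMeasure D.quasiInvariant (D.ac_base L.quasiInvariant)
          (D.base_ac L.quasiInvariant)).tensor (M.ind D))
        (((L.restrict H beta M.quasiInvariant).tensor M).ind D),
      ∀ (u : X) (ξ : L.bundle.fiber u) (η : M.SqSec D u),
        ∃ ζ : ((L.restrict H beta M.quasiInvariant).tensor M).SqSec D u,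
          (∀ x : TopGpd.Fib u, ζ.val x =
            (L.bundle.onUnits H).tmul M.bundle (u := H.unit x.src)
              (L.op (Groupoid.inv x.hom) ξ) (η.val x)) ∧
          U.unitary u (L.bundle.tmul (M.ind D).bundle ξ (M.indVec D η)) =
            ((L.restrict H beta M.quasiInvariant).tensor M).indVec D ζ := by
  choose U hU using L.exists_unitary M D
  refine ⟨⟨U, L.isBorelSection_unitary_iff M D U hU, fun {a b} g z => ?_⟩,
    fun u ξ η => ⟨L.tensorSq M D u ξ η, fun x => rfl, hU u ξ η⟩⟩
  -- both sides are unitary in `z`, so elementary tensors suffice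
  refine L.linearIsometryEquiv_ext_tmul_indVec M D
    ((((L.changeMeasure D.quasiInvariant (D.ac_base L.quasiInvariant)
      (D.base_ac L.quasiInvariant)).tensor (M.ind D)).op g).trans (U b))
    ((U a).trans ((((L.restrict H beta M.quasiInvariant).tensor M).ind D).op g))
    (fun ξ η => ?_) z
  refine (congrArg (U b) ((L.changeMeasure_tensor_op_tmul M D _ _ _ g ξ _).trans
    (congrArg _ (M.ind_op_indVec D g η)))).trans ?_
  refine (hU b _ _).trans (Eq.trans ?_ (congrArg
    ((((L.restrict H beta M.quasiInvariant).tensor M).ind D).op g) (hU a ξ η)).symm)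
  rw [TopGpd.Rep.ind_op_indVec, L.indPre_tensorSq]
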